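/- **Notation.** For integers $c_1,\dots,c_l$ let $[c_1,\dots,c_l]^-=c_1-\cfrac{1}{c_2-\cfrac{1}{\ddots-\cfrac1{c_l}}}$. A rational number $x/a$ in lowest terms (or $1/0$) is of $\frac11$-, $\frac10$- or $\frac01$-type according to $(x,a)\equiv(1,1),(1,0),(0,1) \pmod 2$. *Rational link diagrams.* For $\alpha\in\mathbb Q\cap(0,1)$ write $\alpha=1/(a_1+1/(a_2+\cdots+1/a_n))$ with $n$ odd and all $a_i\ge1$ integers. The diagram $D(\alpha)$ has four strings running from left to right, numbered $1,\dots,4$ from top to bottom: first $a_1$ half twists of the strings in positions $2,3$, then $a_2$ half twists of those in positions $1,2$, then $a_3$ half twists of those in positions $2,3$, and so on. In the twists of positions $2,3$ the string that goes upwards from left to right is the over-string; in those of positions $1,2$ it is the under-string. At each of the two ends position $1$ is joined to $2$ and $3$ to $4$ by an arc. If the denominator of $\alpha$ is odd, $D(\alpha)$ is a knot diagram, with any orientation. If it is even, $D(\alpha)$ is a diagram of a two-component link, whose components contain one left arc each; in $D(\alpha)$ both left arcs are oriented downwards, and $D_{+-}(\alpha)$ is the same diagram with the orientation of the component of the lower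 left arc reversed. Let $\mathrm{wr}(\alpha)=\mathrm{wr}_{++}(\alpha)$ and $\mathrm{wr}_{+-}(\alpha)$ be the writhes (sums of the signs of all crossings) of $D(\alpha)$ and, when the denominator is even, of $D_{+-}(\alpha)$. *Seifert paths.* The ancestor triangle $\mathrm{YAT}(\alpha)$ is the chain of fundamental triangles with left vertex $\frac xa$, right vertex $\frac yb$ and bottom vertex $\frac{x+y}{a+b}$, which starts with left vertex $\frac01$ and right vertex $\frac10$; after a triangle with bottom vertex $m\neq\alpha$ comes the one with the same left vertex and right vertex $m$ if $\alpha<m$, and the one with left vertex $m$ and the same right vertex if $m<\alpha$; the chain ends with bottom vertex $\alpha$. A Seifert path of $\alpha$ is a downward path from $\frac10$ to $\alpha$ along edges of $\mathrm{YAT}(\alpha)$ (the top edge may be passed from $\frac10$ to $\frac01$) such that either each of its edges joins vertices of $\frac11$- and $\frac10$-type, or each of its edges joins vertices of $\frac10$- and $\frac01$-type. Let $\gamma_\alpha$ be the unique Seifert path of $\alpha$ if the denominator of $\alpha$ is odd, and the one with vertices of $\frac10$- and $\frac01$-type if it is even. A path crosses $\mathrm{YAT}(\alpha)$ each time that it passes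 through an edge joining the left and the right vertex of a fundamental triangle (the edge between $\frac10$ and $\frac01$ included). **Theorem.** Let $\alpha\in\mathbb Q\cap(0,1)$ and $\alpha^{-1}=[c_1,\dots,c_l]^-$ with $l\ge1$ and integers $c_j\ge2$. For $1\le j\le l$ put $\alpha_j=\frac1{[c_1,\dots,c_j]^-}$, $\beta_j=\frac1{[c_1,\dots,c_{j-1},c_j-1]^-}$, let $E_j$ be the edge between $\alpha_j$ and $\beta_j$, and let $z_j(\alpha_j)$ be the number of times that $\gamma_{\alpha_j}$ crosses $\mathrm{YAT}(\alpha_j)$ from its start $\frac10$ until it first meets an end point of $E_j$. Let $\epsilon(c)=+$ if $c$ is even and $\epsilon(c)=-$ if $c$ is odd. 1. If $l=1$, then $\mathrm{wr}(\alpha)=(-1)^{c_1}c_1$; if moreover $c_1$ is even, then $\mathrm{wr}_{+-}(\alpha)=-c_1$. 2. If $l=2$, then $\mathrm{wr}(\alpha)=(-1)^{(c_1-1)c_2}c_1+(-1)^{c_1}c_2-1$; if moreover $c_1,c_2$ are both odd, then $\mathrm{wr}_{+-}(\alpha)=-c_1+c_2-1$. 3. Let $l\ge3$. - (i) If $\alpha_{l-1}$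 is of $\frac10$-type and $\alpha$ of $\frac11$-type, then $\mathrm{wr}(\alpha)=\mathrm{wr}_{+-}(\alpha_{l-1})+(-1)^{z_{l-1}(\alpha_{l-1})+\frac{1+(-1)^{c_l}}2+1}(c_l-1)$. - (ii) If $\alpha_{l-1}$ is of $\frac01$-type and $\alpha$ of $\frac11$-type, then $\mathrm{wr}(\alpha)=\mathrm{wr}_{+\epsilon(c_l)}(\alpha_{l-2})+(-1)^{z_{l-2}(\alpha_{l-2})+\frac{1+(-1)^{c_{l-1}}}2+\frac{1-(-1)^{c_l}}2}(-c_{l-1}+c_l+2)$. - (iii) If $\alpha_{l-1}$ is of $\frac10$-type and $\alpha$ of $\frac01$-type, then $\mathrm{wr}(\alpha)=\mathrm{wr}(\alpha_{l-1})+(-1)^{z_{l-1}(\alpha_{l-1})+\frac{1+(-1)^{c_l}}2}(c_l-1)$. - (iv) If $\alpha_{l-1}$ is of $\frac11$-type and $\alpha$ of $\frac01$-type, then $\mathrm{wr}(\alpha)=\mathrm{wr}(\alpha_{l-2})+(-1)^{z_{l-2}(\alpha_{l-2})+\frac{1+(-1)^{c_{l-1}}}2}(-c_{l-1}+c_l+2)$.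 - (v) If $\alpha_{l-1}$ is of $\frac01$-type and $\alpha$ of $\frac10$-type, then $\mathrm{wr}(\alpha)=\mathrm{wr}(\alpha_{l-1})+(-1)^{z_{l-1}(\alpha_{l-1})+\frac{1+(-1)^{c_l}}2}(c_l-1)$ and $\mathrm{wr}_{+-}(\alpha)=\mathrm{wr}_{+\epsilon(c_l-1)}(\alpha_{l-2})+(-1)^{z_{l-2}(\alpha_{l-2})+\frac{1+(-1)^{c_{l-1}}}2+\frac{1+(-1)^{c_l}}2}(-c_{l-1}+c_l+2)$. - (vi) If $\alpha_{l-1}$ is of $\frac11$-type and $\alpha$ of $\frac10$-type, then $\mathrm{wr}(\alpha)=\mathrm{wr}(\alpha_{l-2})+(-1)^{z_{l-2}(\alpha_{l-2})+\frac{1+(-1)^{c_{l-1}}}2}(-c_{l-1}+c_l+2)$ and $\mathrm{wr}_{+-}(\alpha)=\mathrm{wr}(\alpha_{l-1})+(-1)^{z_{l-2}(\alpha_{l-2})+\frac{1+(-1)^{c_{l-1}}}2+1}(c_l-1)$. -/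

import Mathlib

/-! ### Negative continued fractions -/

/-- `[c₁, …, c_l]⁻ = c₁ - 1/(c₂ - 1/(⋯ - 1/c_l))`. -/
def negCF : List ℕ → ℚ
  | [] => 0
  | [c] => c
  | c :: c' :: cs => c - 1 / negCF (c' :: cs)

/-- `α_j = 1 / [c₁, …, c_j]⁻` for a sequence `c 1, c 2, …` (the value `c 0` is not used). -/
def negConv (c : ℕ → ℕ) (j : ℕ) : ℚ :=
  1 / negCF ((List.range j).map fun i => c (i + 1))

/-- `β_j = 1 / [c₁, …, c_{j-1}, c_j - 1]⁻` for `j ≥ 1`. -/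
def negConvPred (c : ℕ → ℕ) (j : ℕ) : ℚ :=
  1 / negCF (((List.range (j - 1)).map fun i => c (i + 1)) ++ [c j - 1])

/-! ### Regular continued fractions of odd length -/

/-- `a₁ + 1/(a₂ + 1/(⋯ + 1/a_n))`. -/
def regCF : List ℕ → ℚ
  | [] => 0
  | [a] => a
  | a :: a' :: as => a + 1 / regCF (a' :: as)

/-- The quotients of the Euclidean algorithm for `(q, p)`. -/
def euclidQuotients (q p : ℕ) : List ℕ :=
  if _h : p = 0 then [] else q / p :: euclidQuotients p (q % p)
termination_by p
decreasing_by exact Nat.mod_lt _ (Nat.pos_of_ne_zero _h)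

/-- Replaces the last entry `a` by the two entries `a - 1, 1`; this does not change the value of
the continued fraction and changes the parity of its length. -/
def splitLast : List ℕ → List ℕ
  | [] => []
  | [a] => [a - 1, 1]
  | a :: a' :: as => a :: splitLast (a' :: as)

/-- The list `a₁, …, a_n` of positive integers, with `n` odd, such that
`α = [0, a₁, …, a_n] = 1/(a₁ + 1/(a₂ + ⋯ + 1/a_n))`, for `0 < α < 1`
(see `oddExpansion_spec`). -/
def oddExpansion (α : ℚ) : List ℕ :=
  let a := euclidQuotients α.den α.num.toNat
  if Odd a.length then a else splitLast a

theorem euclidQuotients_zero (q : ℕ) : euclidQuotients q 0 = [] := by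
  rw [euclidQuotients]; simp

theorem euclidQuotients_pos (q p : ℕ) (hp : 0 < p) :
    euclidQuotients q p = q / p :: euclidQuotients p (q % p) := by
  rw [euclidQuotients]; simp [hp.ne']

theorem regCF_cons (a : ℕ) (L : List ℕ) (hL : L ≠ []) : regCF (a :: L) = a + 1 / regCF L := by
  cases L with
  | nil => exact absurd rfl hL
  | cons b L => rfl

theorem splitLast_cons (a : ℕ) (L : List ℕ) (hL : L ≠ []) :
    splitLast (a :: L) = a :: splitLast L := by
  cases L with
  | nil => exact absurd rfl hL
  | cons b L => rfl

theorem euclidQuotients_ne_nil (q p : ℕ) (hp : 0 < p) : euclidQuotients q p ≠ [] := by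
  rw [euclidQuotients_pos q p hp]; simp

theorem regCF_euclidQuotients (q p : ℕ) (hp : 0 < p) :
    regCF (euclidQuotients q p) = (q : ℚ) / p := by
  induction p using Nat.strong_induction_on generalizing q with
  | _ p ih =>
    rw [euclidQuotients_pos q p hp]
    have hdiv : (q : ℚ) = p * (q / p : ℕ) + (q % p : ℕ) := by
      exact_mod_cast (Nat.div_add_mod q p).symm
    have hp' : (p : ℚ) ≠ 0 := by exact_mod_cast hp.ne'
    rcases Nat.eq_zero_or_pos (q % p) with h | h
    · rw [h, euclidQuotients_zero, regCF]
      rw [h] at hdiv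
      rw [eq_div_iff hp', hdiv]; push_cast; ring
    · rw [regCF_cons _ _ (euclidQuotients_ne_nil _ _ h), ih _ (Nat.mod_lt _ hp) p h]
      have h' : ((q % p : ℕ) : ℚ) ≠ 0 := by exact_mod_cast h.ne'
      rw [one_div_div, eq_div_iff hp']
      conv_rhs => rw [hdiv]
      field_simp

/-- The quotients are positive, and the last one is at least `2`. -/
theorem euclidQuotients_entries (q p : ℕ) (hp : 0 < p) (hpq : p < q) :
    (∀ a ∈ euclidQuotients q p, 0 < a) ∧ ∀ a, (euclidQuotients q p).getLast? = some a → 2 ≤ a := by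
  induction p using Nat.strong_induction_on generalizing q with
  | _ p ih =>
    rw [euclidQuotients_pos q p hp]
    have h1 : 0 < q / p := Nat.div_pos hpq.le hp
    rcases Nat.eq_zero_or_pos (q % p) with h | h
    · rw [h, euclidQuotients_zero]
      refine ⟨by simpa using h1, ?_⟩
      intro a ha
      simp at ha
      subst ha
      have := Nat.div_add_mod q p
      rw [h] at this
      by_contra hlt
      have : q / p = 1 := by omega
      simp_all
    · obtain ⟨i1, i2⟩ := ih _ (Nat.mod_lt _ hp) p h (Nat.mod_lt _ hp)
      refine ⟨?_, ?_⟩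
      · intro a ha
        rcases List.mem_cons.1 ha with rfl | ha
        · exact h1
        · exact i1 a ha
      · intro a ha
        apply i2
        rwa [List.getLast?_cons_of_ne_nil (euclidQuotients_ne_nil _ _ h)] at ha

theorem splitLast_spec (L : List ℕ) (hL : L ≠ []) (hpos : ∀ a ∈ L, 0 < a)
    (hlast : ∀ a, L.getLast? = some a → 2 ≤ a) :
    (splitLast L).length = L.length + 1 ∧ (∀ a ∈ splitLast L, 0 < a) ∧
      regCF (splitLast L) = regCF L ∧ splitLast L ≠ [] := by
  induction L with
  | nil => exact absurd rfl hL
  | cons a L ih =>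
    by_cases h : L = []
    · subst h
      have h2 : 2 ≤ a := hlast a (by simp)
      refine ⟨by simp [splitLast], ?_, ?_, by simp [splitLast]⟩
      · simp [splitLast]; omega
      · simp [splitLast, regCF]
        rw [Nat.cast_sub (by omega)]; simp
    · obtain ⟨i1, i2, i3, i4⟩ := ih h (fun b hb => hpos b (List.mem_cons_of_mem _ hb))
        (fun b hb => hlast b (by rwa [List.getLast?_cons_of_ne_nil h]))
      rw [splitLast_cons _ _ h]
      refine ⟨by simp [i1], ?_, ?_, by simp⟩
      · intro b hb
        rcases List.mem_cons.1 hb with rfl | hb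
        · exact hpos _ (by simp)
        · exact i2 b hb
      · rw [regCF_cons _ _ i4, regCF_cons _ _ h, i3]

/-- `oddExpansion α` is the expansion `α = [0, a₁, …, a_n]` with `n` odd and positive `a_i`. -/
theorem oddExpansion_spec (α : ℚ) (h0 : 0 < α) (h1 : α < 1) :
    Odd (oddExpansion α).length ∧ (∀ a ∈ oddExpansion α, 0 < a) ∧
      α = 1 / regCF (oddExpansion α) := by
  have hnum : 0 < α.num := Rat.num_pos.2 h0
  have hp : 0 < α.num.toNat := by omega
  have hlt : α.num.toNat < α.den := by
    have := (Rat.num_lt_denom_iff).2 h1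
    omega
  have hcast : ((α.num.toNat : ℕ) : ℚ) = (α.num : ℚ) := by
    have : ((α.num.toNat : ℕ) : ℤ) = α.num := Int.toNat_of_nonneg hnum.le
    exact_mod_cast this
  have hval : α = 1 / regCF (euclidQuotients α.den α.num.toNat) := by
    rw [regCF_euclidQuotients _ _ hp, one_div_div, hcast, Rat.num_div_den]
  obtain ⟨e1, e2⟩ := euclidQuotients_entries _ _ hp hlt
  have e3 := euclidQuotients_ne_nil α.den _ hp
  unfold oddExpansion
  simp only
  split_ifs with h
  · exact ⟨h, e1, hval⟩
  · obtain ⟨s1, s2, s3, -⟩ := splitLast_spec _ e3 e1 e2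
    refine ⟨?_, s2, by rw [s3]; exact hval⟩
    rw [s1]
    exact (Nat.not_odd_iff_even.1 h).add_one

/-! ### Four-string plat diagrams, orientations and writhe

A diagram is drawn from left to right with four strings, at the heights `0, -1, -2, -3`
(positions `0, 1, 2, 3`, position `0` on top). It is a sequence of crossings of neighbouring
strings, closed at the left end and at the right end by two arcs each, which join position `0` to
position `1` and position `2` to position `3`. -/

/-- A crossing, at which the strings in the positions `pos` and `pos + 1` are exchanged. The
*descending* string goes, from left to right, from `pos` to `pos + 1`, the *ascending* one from
`pos + 1` to `pos`; `descOver` tells whether the descending string is the over-string. -/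
structure PlatCrossing where
  pos : Fin 3
  descOver : Bool

/-- Directions of the four strings on a vertical line: `1` is left to right, `-1` right to left. -/
abbrev Dirs := Fin 4 → ℤˣ

namespace PlatCrossing

/-- Directions just to the right of a crossing, given those just to its left. -/
def through (x : PlatCrossing) (d : Dirs) : Dirs :=
  fun i => d (Equiv.swap x.pos.castSucc x.pos.succ i)

/-- The tangent vector at the crossing of its descending string. -/
def descVec (x : PlatCrossing) (d : Dirs) : ℤ × ℤ := (d x.pos.castSucc : ℤ) • (1, -1)

/-- The tangent vector at the crossing of its ascending string. -/
def ascVec (x : PlatCrossing) (d : Dirs) : ℤ × ℤ := (d x.pos.succ : ℤ) • (1, 1)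

/-- The sign of an oriented crossing: `1` if the over-string is turned to the under-string
counterclockwise (through less than a half turn), `-1` otherwise. -/
def sign (x : PlatCrossing) (d : Dirs) : ℤ :=
  let o := if x.descOver then x.descVec d else x.ascVec d
  let u := if x.descOver then x.ascVec d else x.descVec d
  Int.sign (o.1 * u.2 - o.2 * u.1)

end PlatCrossing

/-- Directions at the right end of a diagram, given those at its left end. -/
def rightDirs : List PlatCrossing → Dirs → Dirs
  | [], d => d
  | x :: w, d => rightDirs w (x.through d)

/-- The directions `d` at one end of the diagram are compatible with the two closing arcs. -/
def CapCompatible (d : Dirs) : Prop := d 0 = -d 1 ∧ d 2 = -d 3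

instance (d : Dirs) : Decidable (CapCompatible d) := by
  unfold CapCompatible; infer_instance

/-- The directions `d` at the left end extend to an orientation of the whole closed diagram. -/
def IsOrientation (w : List PlatCrossing) (d : Dirs) : Prop :=
  CapCompatible d ∧ CapCompatible (rightDirs w d)

instance (w : List PlatCrossing) (d : Dirs) : Decidable (IsOrientation w d) := by
  unfold IsOrientation; infer_instance

/-- The writhe of a diagram with the orientation that is given by `d` at the left end: the sum of
the signs of all crossings. -/
def diagramWrithe : List PlatCrossing → Dirs → ℤ
  | [], _ => 0
  | x :: w, d => x.sign d + diagramWrithe w (x.through d)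

/-- The boxes of twists of a rational link diagram: `a₁` half twists of the two middle strings,
then `a₂` half twists, in the opposite sense, of the two top strings, then `a₃` half twists of the
middle strings, and so on. The Boolean tells whether the next box is on the middle strings. -/
def twistBoxes : Bool → List ℕ → List PlatCrossing
  | _, [] => []
  | true, a :: as => List.replicate a ⟨1, false⟩ ++ twistBoxes false as
  | false, a :: as => List.replicate a ⟨0, true⟩ ++ twistBoxes true as

/-- The rational link diagram `D(α)`, for `0 < α < 1`. -/
def rationalDiagram (α : ℚ) : List PlatCrossing := twistBoxes true (oddExpansion α)

/-- Directions at the left end: the upper left arc is oriented downwards as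
`position 0 → position 1`, the lower left arc in the same way (`position 2 → position 3`) if
`s = 1`, and the other way if `s = -1`. -/
def leftDirs (s : ℤˣ) : Dirs := ![-1, 1, -s, s]

/-- The orientation of `D(α)`. If the denominator of `α` is even, then the two left arcs
lie on different components, and they are oriented in the same way. If the denominator is odd, then
`D(α)` is a knot, and only one of the two choices is an orientation (reversing all strings does not
matter for the writhe). -/
def stdDirs (α : ℚ) : Dirs :=
  if Even α.den then leftDirs 1
  else if IsOrientation (rationalDiagram α) (leftDirs 1) then leftDirs 1
  else leftDirs (-1)

/-- Continuants modulo `2`: the numerator and the denominator of `[a₁, …, a_n]`. -/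
def parityCF : List ℕ → ZMod 2 × ZMod 2
  | [] => (1, 0)
  | a :: as => ((a : ZMod 2) * (parityCF as).1 + (parityCF as).2, (parityCF as).1)

/-- For directions `d` at the left end with two strings each way, the right end of the diagram
fails to be compatible with the closing arcs exactly if `d` agrees at the top and at this position
(see `capCompatible_rightDirs`). -/
def badIndex (b : Bool) (x : ZMod 2 × ZMod 2) : Fin 4 :=
  if b then (if x = (0, 1) then 1 else if x = (1, 1) then 2 else 3)
  else (if x = (1, 0) then 1 else if x = (1, 1) then 2 else 3)

theorem rightDirs_append (w w' : List PlatCrossing) (d : Dirs) :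
    rightDirs (w ++ w') d = rightDirs w' (rightDirs w d) := by
  induction w generalizing d with
  | nil => rfl
  | cons x w ih => exact ih _

theorem rightDirs_replicate (x : PlatCrossing) (n : ℕ) (d : Dirs) :
    rightDirs (List.replicate n x) d = if Even n then d else x.through d := by
  induction n generalizing d with
  | zero => simp [rightDirs]
  | succ n ih =>
    rw [List.replicate_succ, rightDirs, ih]
    have h : x.through (x.through d) = d := by
      funext i; simp [PlatCrossing.through]
    by_cases hn : Even n
    · simp [hn, Nat.even_add_one]
    · simp [hn, Nat.even_add_one, h]

/-- Two strings run each way. -/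
def BalancedDirs (d : Dirs) : Prop := (d 0 : ℤ) + d 1 + d 2 + d 3 = 0

instance (d : Dirs) : Decidable (BalancedDirs d) := by
  unfold BalancedDirs; infer_instance

theorem balanced_through (x : PlatCrossing) (d : Dirs) (hd : BalancedDirs d) :
    BalancedDirs (x.through d) := by
  obtain ⟨p, b⟩ := x
  have h : ∀ (p : Fin 3) (d : Dirs), BalancedDirs d →
      BalancedDirs fun i => d (Equiv.swap p.castSucc p.succ i) := by decide
  exact h p d hd

theorem parityCF_ne (L : List ℕ) : parityCF L ≠ (0, 0) := by
  induction L with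
  | nil => decide
  | cons a L ih =>
    simp only [parityCF]
    generalize (a : ZMod 2) = a at *
    generalize parityCF L = x at *
    revert a x; decide

theorem through_badIndex (b : Bool) (e : Bool) (a : ℕ) (x : ZMod 2 × ZMod 2) (hx : x ≠ (0, 0))
    (d : Dirs) (hd : BalancedDirs d) :
    ((if Even a then d else PlatCrossing.through ⟨if b then 1 else 0, e⟩ d) 0 ≠
      (if Even a then d else PlatCrossing.through ⟨if b then 1 else 0, e⟩ d)
        (badIndex (!b) x)) ↔ d 0 ≠ d (badIndex b ((a : ZMod 2) * x.1 + x.2, x.1)) := by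
  by_cases ha : Even a
  · rw [(ZMod.natCast_eq_zero_iff_even).2 ha]
    simp only [ha, if_true]
    revert b x d
    decide
  · rw [(ZMod.natCast_eq_one_iff_odd).2 (Nat.not_even_iff_odd.1 ha)]
    simp only [ha, if_false, PlatCrossing.through]
    revert b x d
    decide

theorem capCompatible_rightDirs (L : List ℕ) (b : Bool) (hb : b = true ↔ Odd L.length)
    (d : Dirs) (hd : BalancedDirs d) :
    CapCompatible (rightDirs (twistBoxes b L) d) ↔ d 0 ≠ d (badIndex b (parityCF L)) := by
  induction L generalizing b d with
  | nil =>
    have : b = false := by simpa using hb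
    subst this
    simp only [twistBoxes, rightDirs, parityCF]
    revert d
    decide
  | cons a L ih =>
    have hb' : (!b) = true ↔ Odd L.length := by
      rw [List.length_cons, Nat.odd_add_one] at hb
      cases b <;> simp_all
    have key := through_badIndex b (!b) a (parityCF L) (parityCF_ne L) d hd
    have e : twistBoxes b (a :: L) =
        List.replicate a ⟨if b then 1 else 0, !b⟩ ++ twistBoxes (!b) L := by
      cases b <;> rfl
    rw [e, rightDirs_append, rightDirs_replicate, parityCF, ← key]
    apply ih _ hb'
    by_cases ha : Even a
    · rw [if_pos ha]
      exact hd
    · rw [if_neg ha]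
      exact balanced_through _ _ hd

theorem parityCF_euclidQuotients (q p : ℕ) (h : Nat.Coprime q p) :
    parityCF (euclidQuotients q p) = ((q : ZMod 2), (p : ZMod 2)) := by
  induction p using Nat.strong_induction_on generalizing q with
  | _ p ih =>
    rcases Nat.eq_zero_or_pos p with rfl | hp
    · rw [euclidQuotients_zero, (Nat.coprime_zero_right q).1 h]
      simp [parityCF]
    · rw [euclidQuotients_pos q p hp, parityCF, ih _ (Nat.mod_lt _ hp) p]
      · have : (q : ZMod 2) = (p * (q / p) + q % p : ℕ) := by rw [Nat.div_add_mod]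
        rw [this]
        push_cast
        ring_nf
      · rw [Nat.coprime_comm, Nat.Coprime, ← Nat.gcd_rec, ← Nat.Coprime, Nat.coprime_comm]
        exact h

theorem parityCF_splitLast (L : List ℕ) (hpos : ∀ a ∈ L, 0 < a) :
    parityCF (splitLast L) = parityCF L := by
  induction L with
  | nil => rfl
  | cons a L ih =>
    by_cases h : L = []
    · subst h
      have h0 : 0 < a := hpos a (by simp)
      obtain ⟨k, rfl⟩ : ∃ k, a = k + 1 := ⟨a - 1, by omega⟩
      simp [splitLast, parityCF]
    · rw [splitLast_cons _ _ h, parityCF, parityCF,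
        ih fun b hb => hpos b (List.mem_cons_of_mem _ hb)]

theorem isOrientation_leftDirs_iff (α : ℚ) (h0 : 0 < α) (h1 : α < 1) (s : ℤˣ) :
    IsOrientation (rationalDiagram α) (leftDirs s) ↔
      leftDirs s 0 ≠ leftDirs s (badIndex true ((α.den : ZMod 2), (α.num.toNat : ZMod 2))) := by
  have hnum : 0 < α.num := Rat.num_pos.2 h0
  have hp : 0 < α.num.toNat := by omega
  have hlt : α.num.toNat < α.den := by
    have := (Rat.num_lt_denom_iff).2 h1
    omega
  have hco : Nat.Coprime α.den α.num.toNat := by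
    have := α.reduced
    rw [Nat.coprime_comm]
    rwa [show α.num.natAbs = α.num.toNat by omega] at this
  have hpar : parityCF (oddExpansion α) = ((α.den : ZMod 2), (α.num.toNat : ZMod 2)) := by
    unfold oddExpansion
    simp only
    split_ifs
    · exact parityCF_euclidQuotients _ _ hco
    · rw [parityCF_splitLast _ (euclidQuotients_entries _ _ hp hlt).1,
        parityCF_euclidQuotients _ _ hco]
  have hbal : BalancedDirs (leftDirs s) := by revert s; decide
  have hcap : CapCompatible (leftDirs s) := by revert s; decide
  have hodd := (oddExpansion_spec α h0 h1).1
  rw [IsOrientation, rationalDiagram,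
    capCompatible_rightDirs _ true (by simpa using hodd) _ hbal, hpar]
  simp [hcap]

/-- If the denominator of `α` is even, then both choices at the left end are orientations. -/
theorem isOrientation_of_even (α : ℚ) (h0 : 0 < α) (h1 : α < 1) (h : Even α.den) (s : ℤˣ) :
    IsOrientation (rationalDiagram α) (leftDirs s) := by
  have hco : parityCF (euclidQuotients α.den α.num.toNat) ≠ (0, 0) := parityCF_ne _
  rw [parityCF_euclidQuotients] at hco
  · rw [isOrientation_leftDirs_iff α h0 h1]
    rw [(ZMod.natCast_eq_zero_iff_even).2 h] at hco ⊢
    generalize (α.num.toNat : ZMod 2) = y at *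
    revert y s
    decide
  · have := α.reduced
    have hnum : 0 < α.num := Rat.num_pos.2 h0
    rw [Nat.coprime_comm]
    rwa [show α.num.natAbs = α.num.toNat by omega] at this

/-- If the denominator of `α` is odd, then exactly one of the two choices is an orientation. -/
theorem isOrientation_of_odd (α : ℚ) (h0 : 0 < α) (h1 : α < 1) (h : Odd α.den) :
    IsOrientation (rationalDiagram α) (leftDirs (-1)) ↔
      ¬ IsOrientation (rationalDiagram α) (leftDirs 1) := by
  rw [isOrientation_leftDirs_iff α h0 h1, isOrientation_leftDirs_iff α h0 h1,
    (ZMod.natCast_eq_one_iff_odd).2 h]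
  generalize (α.num.toNat : ZMod 2) = y
  revert y
  decide

/-- The directions chosen for `D(α)` are an orientation. -/
theorem isOrientation_stdDirs (α : ℚ) (h0 : 0 < α) (h1 : α < 1) :
    IsOrientation (rationalDiagram α) (stdDirs α) := by
  unfold stdDirs
  split_ifs with h h'
  · exact isOrientation_of_even α h0 h1 h 1
  · exact h'
  · exact (isOrientation_of_odd α h0 h1 (Nat.not_even_iff_odd.1 h)).2 h'

/-- `wr(α)`, the writhe of `D(α)`. -/
def wr (α : ℚ) : ℤ := diagramWrithe (rationalDiagram α) (stdDirs α)

/-- `wr_{+-}(α)`, for `α` with even denominator: the writhe of the diagram `D_{+-}(α)`, in which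
the component through the lower left arc has the other orientation. -/
def wrPM (α : ℚ) : ℤ := diagramWrithe (rationalDiagram α) (leftDirs (-1))

/-- `wr_{++} = wr` and `wr_{+-}`, selected by a sign. -/
def wrSigned (s : ℤˣ) (α : ℚ) : ℤ := if s = 1 then wr α else wrPM α

/-- `ε(c)`: plus if `c` is even, minus if `c` is odd. -/
def eps (c : ℕ) : ℤˣ := if Even c then 1 else -1

/-! ### The ancestor triangle and Seifert paths -/

/-- A vertex `x/a` of the Stern-Brocot tree, as the pair `(x, a)`; `(1, 0)` is `1/0`. The Farey
sum of two vertices is the sum of pairs. -/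
abbrev FareyVertex := ℕ × ℕ

/-- A non-negative rational number as a vertex. -/
def toVertex (α : ℚ) : FareyVertex := (α.num.toNat, α.den)

/-- `x/a` modulo `2`: the value `(1, 1)`, `(1, 0)`, `(0, 1)` for the vertices of
`1/1`-type, `1/0`-type, `0/1`-type. -/
def parityType (v : FareyVertex) : ZMod 2 × ZMod 2 := (v.1, v.2)

/-- `IsFundamental α L R`: the vertices `L`, `R`, `L + R` are the left, the right and the bottom
vertex of a fundamental triangle of the ancestor triangle `YAT(α)`. These triangles form a chain from
the initial one, with the vertices `0/1`, `1/0`, `1/1`, to the one with the bottom vertex `α`. -/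
inductive IsFundamental (α : ℚ) : FareyVertex → FareyVertex → Prop
  | top : IsFundamental α (0, 1) (1, 0)
  | left {L R : FareyVertex} : IsFundamental α L R →
      α < ((L + R).1 : ℚ) / ((L + R).2 : ℚ) → IsFundamental α L (L + R)
  | right {L R : FareyVertex} : IsFundamental α L R →
      ((L + R).1 : ℚ) / ((L + R).2 : ℚ) < α → IsFundamental α (L + R) R

/-- `(u, v)` is an edge of `YAT(α)`, passed downwards. The top edge is passed
from `1/0` to `0/1`; each other edge joins the bottom vertex of a fundamental triangle to one
of the two other vertices of this triangle. -/
def IsDownEdge (α : ℚ) (u v : FareyVertex) : Prop :=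
  (u = (1, 0) ∧ v = (0, 1)) ∨
    ∃ L R, IsFundamental α L R ∧ (u = L ∨ u = R) ∧ v = L + R

/-- Seifert paths of `α`: downward paths in `YAT(α)` from `1/0` to `α`, such that each edge joins a
vertex of `1/1`-type and one of `1/0`-type, or such that each edge joins a vertex
of `1/0`-type and one of `0/1`-type. -/
def IsSeifertPath (α : ℚ) (γ : List FareyVertex) : Prop :=
  γ.head? = some (1, 0) ∧ γ.getLast? = some (toVertex α) ∧ γ.IsChain (IsDownEdge α) ∧
    (γ.IsChain (fun u v => ({parityType u, parityType v} : Set _) = {(1, 1), (1, 0)}) ∨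
      γ.IsChain (fun u v => ({parityType u, parityType v} : Set _) = {(1, 0), (0, 1)}))

/-- The Seifert paths that may be called `γ_α`: if `α` is of `1/0`-type, then
the vertices of `γ_α` are of `1/0`-type and of `0/1`-type. -/
def IsMainSeifertPath (α : ℚ) (γ : List FareyVertex) : Prop :=
  IsSeifertPath α γ ∧
    (parityType (toVertex α) = (1, 0) →
      ∀ v ∈ γ, parityType v = (1, 0) ∨ parityType v = (0, 1))

open Classical in
/-- The Seifert path `γ_α`. -/
noncomputable def seifertPath (α : ℚ) : List FareyVertex :=
  if h : ∃ γ, IsMainSeifertPath α γ then h.choose else []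

/-- The edge `(u, v)` crosses `YAT(α)`: it joins the left and the right vertex of a fundamental
triangle. These are the edge between `1/0` and `0/1` and the common edges of consecutive fundamental
triangles. -/
def Crosses (α : ℚ) (u v : FareyVertex) : Prop :=
  ∃ L R, IsFundamental α L R ∧ ((u = L ∧ v = R) ∨ (u = R ∧ v = L))

open Classical in
/-- The number of edges of the path that cross `YAT(α)` before the path first meets `E`. -/
noncomputable def crossingsUntil (α : ℚ) (E : Set FareyVertex) : List FareyVertex → ℕ
  | u :: v :: γ =>
      if u ∈ E then 0
      else (if Crosses α u v then 1 else 0) + crossingsUntil α E (v :: γ)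
  | _ => 0

/-- `z_j(α_j)`: the number of times that the Seifert path of `α_j` crosses `YAT(α_j)`
while it goes from `1/0` to the first end point of the edge `E_j` between `α_j` and `β_j` that it
meets. -/
noncomputable def zConv (c : ℕ → ℕ) (j : ℕ) : ℕ :=
  crossingsUntil (negConv c j) {toVertex (negConv c j), toVertex (negConvPred c j)}
    (seifertPath (negConv c j))

/-- `(1 + (-1)^c) / 2`. -/
def evenInd (c : ℕ) : ℕ := if Even c then 1 else 0

/-- `(1 - (-1)^c) / 2`. -/
def oddInd (c : ℕ) : ℕ := if Even c then 0 else 1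

/-! Write `α` as a word in left and right steps of the Stern-Brocot tree. Its letters, with one more
left step at the end, are the crossings of the diagram of `α` (`rationalDiagram_eq`). An orientation
has two strings running each way, so up to reversal it is a state in `Fin 3`: the string parallel to
the top one. Each letter acts on states by a transposition, and the sign of a crossing depends only
on the letter and the state, so the writhe is a sum along the word.

The central point is that the three nonzero parity types, placed at the left, right and bottom
vertex of a triangle, are permuted by the same transpositions (`endParallel_typePlace`). A state
thus records where a fixed type `X` sits in the current triangle. The orientations `++` and `+-`
start at `X = 1/1` and `X = 0/1`, and each extends to the closed diagram exactly if `α` is not of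
type `X`. For the orientation defining `wr α`, `X` is also the type that `γ_α` avoids. This path
starts to the right of `α` and changes sides at each crossing. If it contains the right vertex of
the last triangle, the count stops there and is even; otherwise it enters `α` from the left vertex
and the count is odd. The second case occurs exactly if the right vertex is of type `X`, so the sign
given by `z_j` is read off from the final state (`IsVertexWord.pow_crossingsUntil`).

A further quotient `c` of the negative continued fraction appends one right step and `c - 2` left
steps. If an orientation is admissible before and after this, the writhe changes by `c - 1`
(`wordWrithe_extend`). If it is inadmissible for `α_{l-1}`, the last two quotients are handled
together, starting from `α_{l-2}` (`wordWrithe_extend_extend`). Both lemmas also fix the product of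
the side sign and the parity sign of a quotient, which is how the powers of `-1` in the theorem
arise. The six cases differ in which orientation is followed and how it is named at the earlier
convergent. -/

/-! ### Words of the Stern-Brocot tree

A word is a list of Booleans: `true` is a step to the left, `false` a step to the right. -/

/-- The linear action of a word on pairs. -/
def wordAct : List Bool → ℕ × ℕ → ℕ × ℕ
  | [], v => v
  | true :: w, v => ((wordAct w v).1, (wordAct w v).1 + (wordAct w v).2)
  | false :: w, v => ((wordAct w v).1 + (wordAct w v).2, (wordAct w v).2)

theorem wordAct_append (w w' : List Bool) (v : ℕ × ℕ) :
    wordAct (w ++ w') v = wordAct w (wordAct w' v) := by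
  induction w with
  | nil => rfl
  | cons b w ih => cases b <;> simp [wordAct, ih]

theorem wordAct_add (w : List Bool) (u v : ℕ × ℕ) :
    wordAct w (u + v) = wordAct w u + wordAct w v := by
  induction w with
  | nil => rfl
  | cons b w ih => cases b <;> simp [wordAct, ih] <;> ring

theorem wordAct_nsmul (w : List Bool) (n : ℕ) (v : ℕ × ℕ) :
    wordAct w (n • v) = n • wordAct w v := by
  induction w with
  | nil => rfl
  | cons b w ih => cases b <;> simp only [wordAct, ih] <;> ext <;> simp [mul_add]

theorem wordAct_replicate_true (n : ℕ) (v : ℕ × ℕ) :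
    wordAct (List.replicate n true) v = (v.1, n * v.1 + v.2) := by
  induction n with
  | zero => simp [wordAct]
  | succ n ih => simp [List.replicate_succ, wordAct, ih]; ring

theorem wordAct_replicate_false (n : ℕ) (v : ℕ × ℕ) :
    wordAct (List.replicate n false) v = (v.1 + n * v.2, v.2) := by
  induction n with
  | zero => simp [wordAct]
  | succ n ih => simp [List.replicate_succ, wordAct, ih]; ring

theorem wordAct_coprime (w : List Bool) (v : ℕ × ℕ) (h : Nat.Coprime v.1 v.2) :
    Nat.Coprime (wordAct w v).1 (wordAct w v).2 := by
  induction w with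
  | nil => exact h
  | cons b w ih => cases b <;> simpa [wordAct] using ih

theorem wordAct_one_pos (w : List Bool) : 0 < (wordAct w (1, 1)).1 ∧ 0 < (wordAct w (1, 1)).2 := by
  induction w with
  | nil => simp [wordAct]
  | cons b w ih => cases b <;> simp [wordAct] <;> omega

/-- Different words lead to different vertices of the Stern-Brocot tree. -/
theorem wordAct_one_injective (w w' : List Bool) (h : wordAct w (1, 1) = wordAct w' (1, 1)) :
    w = w' := by
  induction w generalizing w' with
  | nil =>
    cases w' with
    | nil => rfl
    | cons b w' =>
      have := wordAct_one_pos w'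
      cases b <;> simp [wordAct] at h <;> omega
  | cons b w ih =>
    have h1 := wordAct_one_pos w
    cases w' with
    | nil => cases b <;> simp [wordAct] at h <;> omega
    | cons b' w' =>
      have h2 := wordAct_one_pos w'
      cases b <;> cases b' <;> simp [wordAct] at h
      · rw [ih w' (Prod.ext (by omega) (by omega))]
      · omega
      · omega
      · rw [ih w' (Prod.ext (by omega) (by omega))]

theorem toVertex_div (a b : ℕ) (h : Nat.Coprime a b) (hb : 0 < b) :
    toVertex ((a : ℚ) / b) = (a, b) := by
  have hb' : (0 : ℤ) < b := by exact_mod_cast hb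
  have h1 := Rat.num_div_eq_of_coprime hb' (a := (a : ℤ)) (by simpa using h)
  have h2 := Rat.den_div_eq_of_coprime hb' (a := (a : ℤ)) (by simpa using h)
  simp only [Int.cast_natCast] at h1 h2
  unfold toVertex
  rw [h1]
  ext
  · simp
  · exact_mod_cast h2

/-! ### The word of a rational link diagram -/

/-- The crossing of a rational link diagram that corresponds to a letter. -/
def letterCrossing (b : Bool) : PlatCrossing := if b then ⟨1, false⟩ else ⟨0, true⟩

theorem twistBoxes_cons (b : Bool) (a : ℕ) (as : List ℕ) :
    twistBoxes b (a :: as) =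
      (List.replicate a b).map letterCrossing ++ twistBoxes (!b) as := by
  cases b <;> simp [twistBoxes, letterCrossing]

/-- A box of twists is a run of equal letters. The last box consists of left letters; since the tree
starts at `1/1`, a last entry `a` needs only `a - 1` left steps, and the remaining crossing is the
extra `true`. A list beginning with a right box represents the inverse fraction, whence the two
cases for the value. -/
theorem twistBoxes_eq_word (A : List ℕ) (b : Bool) (hb : b = true ↔ Odd A.length) (hA : A ≠ [])
    (hpos : ∀ a ∈ A, 0 < a) :
    ∃ w : List Bool, twistBoxes b A = (w ++ [true]).map letterCrossing ∧
      regCF A = if b then ((wordAct w (1, 1)).2 : ℚ) / (wordAct w (1, 1)).1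
        else ((wordAct w (1, 1)).1 : ℚ) / (wordAct w (1, 1)).2 := by
  induction A generalizing b with
  | nil => exact absurd rfl hA
  | cons a A ih =>
    by_cases h : A = []
    · subst h
      have : b = true := by simpa using hb
      subst this
      obtain ⟨n, rfl⟩ := Nat.exists_eq_add_of_le' (hpos a (by simp))
      refine ⟨List.replicate n true, ?_, ?_⟩
      · rw [twistBoxes_cons, ← List.replicate_succ']; simp [twistBoxes]
      · simp [wordAct_replicate_true, regCF]
    · have hb' : (!b) = true ↔ Odd A.length := by
        rw [List.length_cons, Nat.odd_add_one] at hb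
        cases b <;> simp_all
      obtain ⟨w, h1, h2⟩ := ih (!b) hb' h (fun x hx => hpos x (List.mem_cons_of_mem _ hx))
      refine ⟨List.replicate a b ++ w, ?_, ?_⟩
      · rw [twistBoxes_cons, h1]; simp
      · rw [regCF_cons _ _ h, h2]
        have h3 := wordAct_one_pos w
        have h4 : ((wordAct w (1, 1)).1 : ℚ) ≠ 0 := by exact_mod_cast h3.1.ne'
        have h5 : ((wordAct w (1, 1)).2 : ℚ) ≠ 0 := by exact_mod_cast h3.2.ne'
        rw [wordAct_append]
        cases b
        · simp [wordAct_replicate_false]; field_simp; ring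
        · simp [wordAct_replicate_true]; field_simp

/-- The diagram of a vertex of the Stern-Brocot tree is the word of this vertex, followed by one
further step to the left. -/
theorem rationalDiagram_eq (α : ℚ) (h0 : 0 < α) (h1 : α < 1) (w : List Bool)
    (hw : toVertex α = wordAct w (1, 1)) :
    rationalDiagram α = (w ++ [true]).map letterCrossing := by
  obtain ⟨s1, s2, s3⟩ := oddExpansion_spec α h0 h1
  have hne : oddExpansion α ≠ [] := by
    intro h
    rw [h] at s1
    simp at s1
  obtain ⟨w', e1, e2⟩ := twistBoxes_eq_word _ true (by simpa using s1) hne s2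
  have hp := wordAct_one_pos w'
  rw [if_pos rfl] at e2
  rw [e2, one_div_div] at s3
  have : toVertex α = wordAct w' (1, 1) := by
    rw [s3, toVertex_div _ _ (wordAct_coprime _ _ (by simp)) hp.2]
  rw [rationalDiagram, e1, wordAct_one_injective w w' (hw.symm.trans this)]

/-! ### Words of negative continued fractions -/

/-- The word of `1 / [c₁, …, c_l, d]⁻`, without its first letter `true`. -/
def negWordTail : List ℕ → ℕ → List Bool
  | [], d => List.replicate (d - 2) true
  | c :: cs, d => List.replicate (c - 2) true ++ false :: negWordTail cs d

/-- The word of `1 / [c₁, …, c_l, d]⁻`. -/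
def negWord (cs : List ℕ) (d : ℕ) : List Bool := true :: negWordTail cs d

theorem negWord_append (cs : List ℕ) (c d : ℕ) :
    negWord (cs ++ [c]) d = negWord cs c ++ false :: List.replicate (d - 2) true := by
  have : negWordTail (cs ++ [c]) d = negWordTail cs c ++ false :: List.replicate (d - 2) true := by
    induction cs with
    | nil => rfl
    | cons x cs ih => simp [negWordTail, ih]
  simp [negWord, this]

theorem negCF_cons (a : ℕ) (L : List ℕ) (hL : L ≠ []) : negCF (a :: L) = a - 1 / negCF L := by
  cases L with
  | nil => exact absurd rfl hL
  | cons b L => rfl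

/-- This is the matrix form of `t ↦ c - 1/t`, sending `(x, a)` to `(a, c * a - x)`. The second
identity is additive to avoid subtraction in `ℕ`. -/
theorem wordAct_negWord_cons (c : ℕ) (hc : 2 ≤ c) (cs : List ℕ) (d : ℕ) (v : ℕ × ℕ) :
    (wordAct (negWord (c :: cs) d) v).1 = (wordAct (negWord cs d) v).2 ∧
    (wordAct (negWord (c :: cs) d) v).2 + (wordAct (negWord cs d) v).1 =
      c * (wordAct (negWord cs d) v).2 := by
  obtain ⟨n, rfl⟩ := Nat.exists_eq_add_of_le' hc
  simp [negWord, negWordTail, wordAct, wordAct_append, wordAct_replicate_true]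
  ring

/-- The last entry `x` is kept apart from `d` because the fractions ending in `d` and in `d - 1` are
both read from the word for `d`. As `x` may be `1`, the induction carries only the bound that the
value is at least `1`. -/
theorem negCF_of_wordAct (cs : List ℕ) (hcs : ∀ c ∈ cs, 2 ≤ c) (d x : ℕ) (v : ℕ × ℕ)
    (h : wordAct (negWord [] d) v = (1, x)) (hx : 1 ≤ x) :
    0 < (wordAct (negWord cs d) v).1 ∧
    (wordAct (negWord cs d) v).1 ≤ (wordAct (negWord cs d) v).2 ∧
    negCF (cs ++ [x]) = ((wordAct (negWord cs d) v).2 : ℚ) / (wordAct (negWord cs d) v).1 := by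
  induction cs with
  | nil => simp [h, negCF, hx]
  | cons c cs ih =>
    have hc : 2 ≤ c := hcs c (by simp)
    obtain ⟨i1, i2, i3⟩ := ih fun y hy => hcs y (List.mem_cons_of_mem _ hy)
    obtain ⟨e1, e2⟩ := wordAct_negWord_cons c hc cs d v
    have hlt : 2 * (wordAct (negWord cs d) v).2 ≤ c * (wordAct (negWord cs d) v).2 :=
      Nat.mul_le_mul_right _ hc
    refine ⟨by omega, by omega, ?_⟩
    rw [List.cons_append, negCF_cons _ _ (by simp), i3, e1]
    have h1 : ((wordAct (negWord cs d) v).1 : ℚ) ≠ 0 := by exact_mod_cast i1.ne'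
    have h2 : ((wordAct (negWord cs d) v).2 : ℚ) ≠ 0 := by
      exact_mod_cast (lt_of_lt_of_le i1 i2).ne'
    have e3 : ((wordAct (negWord (c :: cs) d) v).2 : ℚ) + (wordAct (negWord cs d) v).1 =
      c * (wordAct (negWord cs d) v).2 := by exact_mod_cast e2
    field_simp
    linarith

theorem wordAct_negWord_nil (d : ℕ) (hd : 2 ≤ d) (y : ℕ) :
    wordAct (negWord [] d) (1, y) = (1, d - 1 + y) := by
  obtain ⟨n, rfl⟩ := Nat.exists_eq_add_of_le' hd
  simp [negWord, negWordTail, wordAct, wordAct_replicate_true]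
  omega

/-- The vertices `1 / [c₁, …, c_l, d - 1]⁻` and `1 / [c₁, …, c_l, d]⁻` are the right and the bottom
vertex at the end of the word of the latter. -/
theorem toVertex_negCF (cs : List ℕ) (hcs : ∀ c ∈ cs, 2 ≤ c) (d : ℕ) (hd : 2 ≤ d) (y : ℕ) :
    toVertex (1 / negCF (cs ++ [d - 1 + y])) = wordAct (negWord cs d) (1, y) ∧
      0 < 1 / negCF (cs ++ [d - 1 + y]) := by
  obtain ⟨h1, h2, h3⟩ := negCF_of_wordAct cs hcs d (d - 1 + y) (1, y)
    (wordAct_negWord_nil d hd y) (by omega)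
  have h4 := lt_of_lt_of_le h1 h2
  rw [h3, one_div_div]
  exact ⟨toVertex_div _ _ (wordAct_coprime _ _ (by simp)) h4, by positivity⟩

/-! ### Directions and writhe along a word

Directions with two strings each way are described, up to a global reversal, by the string that is
parallel to the top string: `k : Fin 3` stands for the string in position `k + 1`. -/

/-- The directions for which the strings in the positions `0` and `k + 1` have direction `e`, and
the two other ones have direction `-e`. -/
def parallelDirs (e : ℤˣ) (k : Fin 3) : Dirs := fun i => if i = 0 ∨ i = k.succ then e else -e

/-- The string parallel to the top string, after a crossing. -/
def nextParallel (b : Bool) (k : Fin 3) : Fin 3 := if b then Equiv.swap 0 1 k else Equiv.swap 1 2 k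

/-- The sign of a crossing in terms of the string parallel to the top string. -/
def letterSign (b : Bool) (k : Fin 3) : ℤ :=
  if b then (if k = 2 then -1 else 1) else (if k = 0 then 1 else -1)

/-- The string parallel to the top string at the end of a word. -/
def endParallel : List Bool → Fin 3 → Fin 3
  | [], k => k
  | b :: w, k => endParallel w (nextParallel b k)

/-- The writhe of a word. -/
def wordWrithe : List Bool → Fin 3 → ℤ
  | [], _ => 0
  | b :: w, k => letterSign b k + wordWrithe w (nextParallel b k)

/-- The direction `e` may change when the top string is exchanged, but this only reverses all
strings, which affects no sign of a crossing. -/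
theorem through_parallelDirs (b : Bool) (e : ℤˣ) (k : Fin 3) :
    ∃ e' : ℤˣ, (letterCrossing b).through (parallelDirs e k) =
      parallelDirs e' (nextParallel b k) := by
  revert b e k; decide

theorem sign_parallelDirs (b : Bool) (e : ℤˣ) (k : Fin 3) :
    (letterCrossing b).sign (parallelDirs e k) = letterSign b k := by
  revert b e k; decide

theorem rightDirs_parallelDirs (w : List Bool) (e : ℤˣ) (k : Fin 3) :
    ∃ e' : ℤˣ, rightDirs (w.map letterCrossing) (parallelDirs e k) =
      parallelDirs e' (endParallel w k) := by
  induction w generalizing e k with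
  | nil => exact ⟨e, rfl⟩
  | cons b w ih =>
    obtain ⟨e', h⟩ := through_parallelDirs b e k
    rw [List.map_cons, rightDirs, h]
    exact ih _ _

theorem diagramWrithe_parallelDirs (w : List Bool) (e : ℤˣ) (k : Fin 3) :
    diagramWrithe (w.map letterCrossing) (parallelDirs e k) = wordWrithe w k := by
  induction w generalizing e k with
  | nil => rfl
  | cons b w ih =>
    obtain ⟨e', h⟩ := through_parallelDirs b e k
    rw [List.map_cons, diagramWrithe, h, ih, sign_parallelDirs]
    rfl

theorem leftDirs_one : leftDirs 1 = parallelDirs (-1) 1 := by decide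

theorem leftDirs_neg_one : leftDirs (-1) = parallelDirs (-1) 2 := by decide

theorem capCompatible_parallelDirs (e : ℤˣ) (k : Fin 3) :
    CapCompatible (parallelDirs e k) ↔ k ≠ 0 := by
  revert e k; decide

theorem isOrientation_parallelDirs (w : List Bool) (e : ℤˣ) (k : Fin 3) :
    IsOrientation (w.map letterCrossing) (parallelDirs e k) ↔ k ≠ 0 ∧ endParallel w k ≠ 0 := by
  obtain ⟨e', h⟩ := rightDirs_parallelDirs w e k
  rw [IsOrientation, h, capCompatible_parallelDirs, capCompatible_parallelDirs]

theorem endParallel_append (w w' : List Bool) (k : Fin 3) :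
    endParallel (w ++ w') k = endParallel w' (endParallel w k) := by
  induction w generalizing k with
  | nil => rfl
  | cons b w ih => exact ih _

/-- Every letter acts as a transposition of the three states. -/
theorem endParallel_injective (w : List Bool) : Function.Injective (endParallel w) := by
  induction w with
  | nil => exact fun _ _ h => h
  | cons b w ih =>
    intro k k' h
    have h' := ih h
    clear h ih
    revert b k k'
    decide

theorem wordWrithe_append (w w' : List Bool) (k : Fin 3) :
    wordWrithe (w ++ w') k = wordWrithe w k + wordWrithe w' (endParallel w k) := by
  induction w generalizing k with
  | nil => simp [wordWrithe, endParallel]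
  | cons b w ih => simp [wordWrithe, endParallel, ih, add_assoc]

theorem endParallel_replicate_true (n : ℕ) (k : Fin 3) :
    endParallel (List.replicate n true) k = if Even n then k else nextParallel true k := by
  induction n generalizing k with
  | zero => simp [endParallel]
  | succ n ih =>
    rw [List.replicate_succ, endParallel, ih]
    by_cases hn : Even n
    · simp [hn, Nat.even_add_one]
    · simp [hn, Nat.even_add_one, nextParallel]

theorem letterSign_true_next (k : Fin 3) :
    letterSign true (nextParallel true k) = letterSign true k := by
  revert k; decide

theorem wordWrithe_replicate_true (n : ℕ) (k : Fin 3) :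
    wordWrithe (List.replicate n true) k = n * letterSign true k := by
  induction n generalizing k with
  | zero => simp [wordWrithe]
  | succ n ih =>
    rw [List.replicate_succ, wordWrithe, ih, letterSign_true_next]
    push_cast; ring

/-! ### Change of the writhe under further quotients -/

/-- `-1` if the top string and the second one are parallel, `1` otherwise. -/
def sideSign (k : Fin 3) : ℤ := if k = 0 then -1 else 1

theorem evenInd_pow (c : ℕ) : (-1 : ℤ) ^ evenInd c = if Even c then -1 else 1 := by
  unfold evenInd; split_ifs <;> simp

theorem oddInd_pow (c : ℕ) : (-1 : ℤ) ^ oddInd c = if Even c then 1 else -1 := by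
  unfold oddInd; split_ifs <;> simp

theorem even_sub_one_iff (c : ℕ) (hc : 2 ≤ c) : Even (c - 1) ↔ ¬ Even c := by
  obtain ⟨n, rfl⟩ := Nat.exists_eq_add_of_le' hc
  simp [Nat.even_add_one]

theorem even_sub_two_iff (c : ℕ) (hc : 2 ≤ c) : Even (c - 2) ↔ Even c := by
  obtain ⟨n, rfl⟩ := Nat.exists_eq_add_of_le' hc
  simp [Nat.even_add_one]

theorem fin_three_cases (k : Fin 3) : k = 0 ∨ k = 1 ∨ k = 2 := by
  revert k; decide

/-- The effect on the writhe and on the directions of appending one step to the right and some steps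
to the left, if the diagram of the shorter word is compatible with the orientation. -/
theorem wordWrithe_extend (w : List Bool) (k : Fin 3) (c : ℕ) (hc : 2 ≤ c)
    (h : endParallel w k ≠ 1)
    (h' : endParallel (w ++ false :: List.replicate (c - 2) true) k ≠ 1) :
    wordWrithe ((w ++ false :: List.replicate (c - 2) true) ++ [true]) k =
        wordWrithe (w ++ [true]) k + ((c : ℤ) - 1) ∧
      sideSign (endParallel w k) * (-1) ^ evenInd c = 1 := by
  simp only [endParallel_append, endParallel, endParallel_replicate_true,
    even_sub_two_iff c hc] at h'
  simp only [wordWrithe_append, wordWrithe, endParallel_append, endParallel,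
    endParallel_replicate_true, wordWrithe_replicate_true, even_sub_two_iff c hc, evenInd_pow]
  push_cast [hc]
  generalize endParallel w k = s at *
  -- The old final crossing is replaced by `c` crossings. In state `0` admissibility forces `c` even
  -- and all signs are `+1`, so the change is `c - 1`. In state `2` it forces `c` odd; the old
  -- crossing and the new right letter have sign `-1`, and the other `c - 1` crossings have sign
  -- `+1`.
  rcases fin_three_cases s with rfl | rfl | rfl
  · by_cases he : Even c <;>
      simp [he, nextParallel, letterSign, sideSign, Equiv.swap_apply_def] at h' ⊢
    ring
  · exact absurd rfl h
  · by_cases he : Even c <;>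
      simp [he, nextParallel, letterSign, sideSign] at h' ⊢
    ring

/-- The same as `wordWrithe_extend` for two extensions, if the intermediate diagram is not
compatible with the orientation. -/
theorem wordWrithe_extend_extend (w : List Bool) (k : Fin 3) (d c : ℕ) (hd : 2 ≤ d) (hc : 2 ≤ c)
    (h : endParallel (w ++ false :: List.replicate (d - 2) true) k = 1) :
    wordWrithe (((w ++ false :: List.replicate (d - 2) true) ++
          false :: List.replicate (c - 2) true) ++ [true]) k =
        wordWrithe (w ++ [true]) k - (-(d : ℤ) + c + 2) ∧
      sideSign (endParallel w k) * (-1) ^ evenInd d = -1 ∧ endParallel w k ≠ 1 := by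
  simp only [endParallel_append, endParallel, endParallel_replicate_true,
    even_sub_two_iff d hd] at h
  simp only [wordWrithe_append, wordWrithe, endParallel_append, endParallel,
    endParallel_replicate_true, wordWrithe_replicate_true, even_sub_two_iff c hc,
    even_sub_two_iff d hd, evenInd_pow]
  push_cast [hc, hd]
  generalize endParallel w k = s at *
  -- State `1` cannot occur, since `false` takes it to `2`, which `true` fixes. The intermediate
  -- state `1` forces `d` odd from `0` and `d` even from `2`. The second block, together with the
  -- final letter, contributes `-c` in both cases; the first contributes `d - 1` against an old
  -- crossing `1`, or `d - 3` against `-1`.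
  rcases fin_three_cases s with rfl | rfl | rfl
  · by_cases he : Even d <;> by_cases hce : Even c <;>
      simp [he, hce, nextParallel, letterSign, sideSign, Equiv.swap_apply_def] at h ⊢ <;> ring
  · by_cases he : Even d <;>
      simp [he, nextParallel, Equiv.swap_apply_def] at h
  · by_cases he : Even d <;> by_cases hce : Even c <;>
      simp [he, hce, nextParallel, letterSign, sideSign, Equiv.swap_apply_def] at h ⊢ <;> ring

/-! ### Triangles at the end of a word, and parity types -/

/-- The left and the right vertex of the triangle that is reached by a word. -/
def wordTriangle : List Bool → FareyVertex → FareyVertex → FareyVertex × FareyVertex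
  | [], L, R => (L, R)
  | true :: w, L, R => wordTriangle w L (L + R)
  | false :: w, L, R => wordTriangle w (L + R) R

theorem wordTriangle_eq (w : List Bool) (L R : FareyVertex) :
    wordTriangle w L R =
      ((wordAct w (0, 1)).1 • R + (wordAct w (0, 1)).2 • L,
        (wordAct w (1, 0)).1 • R + (wordAct w (1, 0)).2 • L) := by
  induction w generalizing L R with
  | nil => simp [wordTriangle, wordAct]
  | cons b w ih =>
    cases b <;> simp only [wordTriangle, wordAct, ih] <;> ext <;> simp <;> ring

theorem wordTriangle_top (w : List Bool) :
    wordTriangle w (0, 1) (1, 0) = (wordAct w (0, 1), wordAct w (1, 0)) := by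
  rw [wordTriangle_eq]; ext <;> simp

theorem parityType_add (u v : FareyVertex) :
    parityType (u + v) = parityType u + parityType v := by
  simp [parityType]

/-- Two different nonzero parity types, as for the end points of an edge. -/
def DistinctTypes (x y : ZMod 2 × ZMod 2) : Prop := x ≠ 0 ∧ y ≠ 0 ∧ x ≠ y

instance (x y : ZMod 2 × ZMod 2) : Decidable (DistinctTypes x y) := by
  unfold DistinctTypes; infer_instance

theorem DistinctTypes.add_right {x y : ZMod 2 × ZMod 2} (h : DistinctTypes x y) :
    DistinctTypes x (x + y) := by
  revert x y; decide

theorem DistinctTypes.add_left {x y : ZMod 2 × ZMod 2} (h : DistinctTypes x y) :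
    DistinctTypes (x + y) y := by
  revert x y; decide

/-- Whether a parity type `X` is the type `l` of the left vertex (`2`), the type `r` of the right
vertex (`0`) or the type of the bottom vertex (`1`). -/
def typePlace (X l r : ZMod 2 × ZMod 2) : Fin 3 := if X = l then 2 else if X = r then 0 else 1

/-- A left step keeps the left type and, as `l + (l + r) = r` modulo `2`, exchanges the right and
bottom types: the transposition that a middle crossing induces on states. -/
theorem typePlace_add_right (X l r : ZMod 2 × ZMod 2) (hX : X ≠ 0) (h : DistinctTypes l r) :
    typePlace X l (l + r) = nextParallel true (typePlace X l r) := by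
  revert X l r; decide

theorem typePlace_add_left (X l r : ZMod 2 × ZMod 2) (hX : X ≠ 0) (h : DistinctTypes l r) :
    typePlace X (l + r) r = nextParallel false (typePlace X l r) := by
  revert X l r; decide

theorem typePlace_eq_one_iff (X l r : ZMod 2 × ZMod 2) (hX : X ≠ 0) (h : DistinctTypes l r) :
    typePlace X l r = 1 ↔ l + r = X := by
  revert X l r; decide

theorem typePlace_eq_zero_iff (X l r : ZMod 2 × ZMod 2) (h : DistinctTypes l r) :
    typePlace X l r = 0 ↔ r = X := by
  revert X l r; decide

theorem endParallel_typePlace (w : List Bool) (X : ZMod 2 × ZMod 2) (hX : X ≠ 0)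
    (L R : FareyVertex) (h : DistinctTypes (parityType L) (parityType R)) :
    endParallel w (typePlace X (parityType L) (parityType R)) =
        typePlace X (parityType (wordTriangle w L R).1) (parityType (wordTriangle w L R).2) ∧
      DistinctTypes (parityType (wordTriangle w L R).1) (parityType (wordTriangle w L R).2) := by
  induction w generalizing L R with
  | nil => exact ⟨rfl, h⟩
  | cons b w ih =>
    cases b
    · rw [endParallel, ← typePlace_add_left X _ _ hX h, ← parityType_add]
      exact ih _ _ (by rw [parityType_add]; exact h.add_left)
    · rw [endParallel, ← typePlace_add_right X _ _ hX h, ← parityType_add]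
      exact ih _ _ (by rw [parityType_add]; exact h.add_right)

theorem distinctTypes_top : DistinctTypes (parityType (0, 1)) (parityType (1, 0)) := by
  simp [parityType]; decide

/-- The directions at the left end that go with an excluded parity type. -/
def startParallel (X : ZMod 2 × ZMod 2) : Fin 3 := typePlace X (0, 1) (1, 0)

theorem endParallel_startParallel (w : List Bool) (X : ZMod 2 × ZMod 2) (hX : X ≠ 0) :
    endParallel w (startParallel X) =
        typePlace X (parityType (wordAct w (0, 1))) (parityType (wordAct w (1, 0))) ∧
      DistinctTypes (parityType (wordAct w (0, 1))) (parityType (wordAct w (1, 0))) := by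
  have h := endParallel_typePlace w X hX _ _ distinctTypes_top
  rw [wordTriangle_top] at h
  simpa [parityType, startParallel] using h

theorem wordAct_one (w : List Bool) : wordAct w (1, 1) = wordAct w (0, 1) + wordAct w (1, 0) := by
  rw [← wordAct_add]; rfl

/-- The string parallel to the top string is the third one exactly if the vertex of the word is of
the excluded type. -/
theorem endParallel_eq_one_iff (w : List Bool) (X : ZMod 2 × ZMod 2) (hX : X ≠ 0) :
    endParallel w (startParallel X) = 1 ↔ parityType (wordAct w (1, 1)) = X := by
  obtain ⟨h1, h2⟩ := endParallel_startParallel w X hX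
  rw [h1, typePlace_eq_one_iff X _ _ hX h2, wordAct_one, parityType_add]

/-! ### Fundamental triangles -/

/-- Used where a crossing edge changes both the parity of the count and the side of the path. -/
theorem not_iff_iff_iff_of_not_iff {a b c : Prop} (h : ¬ (a ↔ b)) :
    (¬ c ↔ a) ↔ (c ↔ b) := by
  by_cases a <;> by_cases b <;> by_cases c <;> simp_all

/-- The vertex `u` lies on the left of the vertex `v`. -/
def IsLeftOf (u v : FareyVertex) : Prop := u.1 * v.2 < v.1 * u.2

theorem lt_div_iff_isLeftOf (A v : FareyVertex) (hA : 0 < A.2) (hv : 0 < v.2) :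
    (A.1 : ℚ) / A.2 < (v.1 : ℚ) / v.2 ↔ IsLeftOf A v := by
  rw [div_lt_div_iff₀ (by exact_mod_cast hA) (by exact_mod_cast hv), IsLeftOf]
  exact_mod_cast Iff.rfl

/-- The basic properties of a fundamental triangle. -/
theorem IsFundamental.spec {α : ℚ} {A : FareyVertex} (hα : α = (A.1 : ℚ) / A.2) (hA : 0 < A.1)
    (hA' : 0 < A.2) {L R : FareyVertex} (h : IsFundamental α L R) :
    0 < L.2 ∧ IsLeftOf L A ∧ IsLeftOf A R ∧ ∃ w, wordTriangle w (0, 1) (1, 0) = (L, R) := by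
  have app : ∀ (w w' : List Bool) (L R : FareyVertex), wordTriangle (w ++ w') L R =
      wordTriangle w' (wordTriangle w L R).1 (wordTriangle w L R).2 := by
    intro w
    induction w with
    | nil => intros; rfl
    | cons b w ih => intro w' L R; cases b <;> exact ih _ _ _
  induction h with
  | top => exact ⟨by simp, by simpa [IsLeftOf] using hA, by simpa [IsLeftOf] using hA', [], rfl⟩
  | @left L R h hlt ih =>
    obtain ⟨i1, i2, i3, w, hw⟩ := ih
    refine ⟨i1, i2, ?_, w ++ [true], by rw [app, hw]; rfl⟩
    rwa [hα, lt_div_iff_isLeftOf _ _ hA' (by simp; omega)] at hlt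
  | @right L R h hlt ih =>
    obtain ⟨i1, i2, i3, w, hw⟩ := ih
    refine ⟨by simp; omega, ?_, i3, w ++ [false], by rw [app, hw]; rfl⟩
    rwa [hα, lt_div_iff_isLeftOf _ _ (by simp; omega) hA'] at hlt

/-- The triangles of a word are the fundamental triangles of its vertex. -/
theorem IsFundamental.wordTriangle {α : ℚ} {A : FareyVertex} (hα : α = (A.1 : ℚ) / A.2)
    (hA' : 0 < A.2) (w : List Bool) {L R : FareyVertex} (hL : 0 < L.2) (hdet : IsLeftOf L R)
    (h : IsFundamental α L R)
    (hw : A = (wordAct w (1, 1)).1 • R + (wordAct w (1, 1)).2 • L) :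
    IsFundamental α (wordTriangle w L R).1 (wordTriangle w L R).2 := by
  induction w generalizing L R with
  | nil => exact h
  | cons b w ih =>
    have hp := wordAct_one_pos w
    have hLR : 0 < (L + R).2 := by simp; omega
    unfold IsLeftOf at hdet
    cases b
    · refine ih hLR (by simp [IsLeftOf]; nlinarith) (h.right ?_) ?_
      · rw [hα, lt_div_iff_isLeftOf _ _ hLR hA', hw]
        simp [wordAct, IsLeftOf]
        nlinarith [Nat.mul_lt_mul_of_pos_left hdet hp.1]
      · rw [hw]; ext <;> simp [wordAct] <;> ring
    · refine ih hL (by simp [IsLeftOf]; nlinarith) (h.left ?_) ?_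
      · rw [hα, lt_div_iff_isLeftOf _ _ hA' hLR, hw]
        simp [wordAct, IsLeftOf]
        nlinarith [Nat.mul_lt_mul_of_pos_left hdet hp.2]
      · rw [hw]; ext <;> simp [wordAct] <;> ring

/-- A vertex `A = α` of the Stern-Brocot tree, other than the end points of the top edge, with the
word `w` that leads to it. -/
structure IsVertexWord (α : ℚ) (A : FareyVertex) (w : List Bool) : Prop where
  eq_div : α = (A.1 : ℚ) / A.2
  eq_act : A = wordAct w (1, 1)

namespace IsVertexWord

variable {α : ℚ} {A : FareyVertex} {w : List Bool}

theorem pos (h : IsVertexWord α A w) : 0 < A.1 ∧ 0 < A.2 := by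
  rw [h.eq_act]; exact wordAct_one_pos w

theorem spec (h : IsVertexWord α A w) {L R : FareyVertex} (hLR : IsFundamental α L R) :
    0 < L.2 ∧ IsLeftOf L A ∧ IsLeftOf A R ∧ ∃ w, wordTriangle w (0, 1) (1, 0) = (L, R) :=
  hLR.spec h.eq_div h.pos.1 h.pos.2

theorem isFundamental (h : IsVertexWord α A w) :
    IsFundamental α (wordAct w (0, 1)) (wordAct w (1, 0)) := by
  have := IsFundamental.wordTriangle h.eq_div h.pos.2 w (by simp) (by simp [IsLeftOf])
    IsFundamental.top (by rw [h.eq_act]; ext <;> simp)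
  rwa [wordTriangle_top] at this

/-- There is only one fundamental triangle with the bottom vertex `α`. -/
theorem eq_of_add_eq (h : IsVertexWord α A w) {L R : FareyVertex} (hLR : IsFundamental α L R)
    (hA : L + R = A) : L = wordAct w (0, 1) ∧ R = wordAct w (1, 0) := by
  obtain ⟨-, -, -, w', hw'⟩ := h.spec hLR
  rw [wordTriangle_top, Prod.mk.injEq] at hw'
  have : w' = w := by
    apply wordAct_one_injective
    rw [← h.eq_act, wordAct_one, hw'.1, hw'.2, hA]
  subst this
  exact ⟨hw'.1.symm, hw'.2.symm⟩

theorem not_isDownEdge (h : IsVertexWord α A w) (v : FareyVertex) : ¬ IsDownEdge α A v := by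
  have hp := h.pos
  rintro (⟨h1, -⟩ | ⟨L, R, hLR, h1, -⟩)
  · rw [h1] at hp; simp at hp
  · obtain ⟨-, h2, h3, -⟩ := h.spec hLR
    unfold IsLeftOf at h2 h3
    rcases h1 with rfl | rfl <;> omega

theorem eq_or_eq_of_isDownEdge (h : IsVertexWord α A w) {u : FareyVertex}
    (hu : IsDownEdge α u A) : u = wordAct w (0, 1) ∨ u = wordAct w (1, 0) := by
  have hp := h.pos
  rcases hu with ⟨-, h1⟩ | ⟨L, R, hLR, h1, h2⟩
  · rw [h1] at hp; simp at hp
  · obtain ⟨h3, h4⟩ := h.eq_of_add_eq hLR h2.symm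
    rwa [← h3, ← h4]

theorem not_crosses (h : IsVertexWord α A w) (u : FareyVertex) : ¬ Crosses α u A := by
  rintro ⟨L, R, hLR, h1⟩
  obtain ⟨-, h2, h3, -⟩ := h.spec hLR
  unfold IsLeftOf at h2 h3
  rcases h1 with ⟨-, rfl⟩ | ⟨-, rfl⟩ <;> omega

/-- An edge crosses the ancestor triangle exactly if its end points lie on different sides. -/
theorem crosses_iff (h : IsVertexWord α A w) {u v : FareyVertex} (huv : IsDownEdge α u v)
    (hv : v ≠ A) : Crosses α u v ↔ ¬ (IsLeftOf A u ↔ IsLeftOf A v) := by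
  have asymm : ∀ u v : FareyVertex, IsLeftOf u v → ¬ IsLeftOf v u := by
    intro u v h1 h2
    unfold IsLeftOf at h1 h2
    omega
  constructor
  · rintro ⟨L, R, hLR, h1⟩
    obtain ⟨-, h2, h3, -⟩ := h.spec hLR
    have h4 := asymm _ _ h2
    rcases h1 with ⟨rfl, rfl⟩ | ⟨rfl, rfl⟩ <;> tauto
  · intro hside
    rcases huv with ⟨rfl, rfl⟩ | ⟨L, R, hLR, h1, rfl⟩
    · exact ⟨_, _, IsFundamental.top, Or.inr ⟨rfl, rfl⟩⟩
    · obtain ⟨h0, h2, h3, w', hw'⟩ := h.spec hLR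
      have h4 := asymm _ _ h2
      have hpos : 0 < (L + R).2 := by simp; omega
      -- A change of sides leaves only one possible start `u`; the edge then joins the left and
      -- right vertices of the next triangle of the chain.
      by_cases hA : IsLeftOf A (L + R)
      · have hu : u = L := by
          rcases h1 with rfl | rfl
          · rfl
          · tauto
        exact ⟨L, L + R, hLR.left (by
          rwa [h.eq_div, lt_div_iff_isLeftOf _ _ h.pos.2 hpos]), Or.inl ⟨hu, rfl⟩⟩
      · have hu : u = R := by
          rcases h1 with rfl | rfl
          · tauto
          · rfl
        refine ⟨L + R, R, hLR.right ?_, Or.inr ⟨hu, rfl⟩⟩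
        rw [h.eq_div, lt_div_iff_isLeftOf _ _ hpos h.pos.2]
        -- Otherwise `L + R` is on neither side of `α`, so it equals `α` as a fraction, hence as a
        -- coprime pair.
        by_contra hA'
        apply hv
        rw [wordTriangle_top, Prod.mk.injEq] at hw'
        have c1 := wordAct_coprime w' (1, 1) (by simp)
        have c2 := wordAct_coprime w (1, 1) (by simp)
        rw [← h.eq_act] at c2
        rw [wordAct_one, hw'.1, hw'.2] at c1
        have e := toVertex_div _ _ c1 hpos
        have e' := toVertex_div _ _ c2 h.pos.2
        have : ((L + R).1 : ℚ) / (L + R).2 = (A.1 : ℚ) / A.2 := by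
          rw [div_eq_div_iff (by exact_mod_cast hpos.ne') (by exact_mod_cast h.pos.2.ne')]
          unfold IsLeftOf at hA hA'
          exact_mod_cast (by omega : (L + R).1 * A.2 = A.1 * (L + R).2)
        rw [this, e'] at e
        exact e.symm

/-! ### Parity of the number of crossings -/

open Classical in
/-- The parity of the number of crossings of a downward path to `α`. -/
theorem even_crossingsUntil (h : IsVertexWord α A w) (γ : List FareyVertex) (u : FareyVertex)
    (hu : u ≠ A) (hchain : (u :: γ).IsChain (IsDownEdge α)) (hlast : (u :: γ).getLast? = some A) :
    ((Even (crossingsUntil α {A, wordAct w (1, 0)} (u :: γ)) ↔ IsLeftOf A u) ↔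
      wordAct w (1, 0) ∈ u :: γ) ∧
    (wordAct w (0, 1) ∈ u :: γ ∨ wordAct w (1, 0) ∈ u :: γ) := by
  obtain ⟨-, hl, hr, -⟩ := h.spec h.isFundamental
  induction γ generalizing u with
  | nil => simp at hlast; exact absurd hlast hu
  | cons v γ ih =>
    rw [List.isChain_cons_cons] at hchain
    rw [List.getLast?_cons_cons] at hlast
    -- At the right vertex the count stops at zero, and this vertex lies to the right of `α`.
    by_cases huR : u = wordAct w (1, 0)
    · subst huR
      simp [crossingsUntil, hr]
    · have huE : u ∉ ({A, wordAct w (1, 0)} : Set FareyVertex) := by simp [hu, huR]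
      -- The path now ends with the edge from the left vertex to `α`, which does not cross: the
      -- count is zero, but on the left side.
      by_cases hv : v = A
      · subst hv
        have hγ : γ = [] := by
          cases γ with
          | nil => rfl
          | cons x γ =>
            rw [List.isChain_cons_cons] at hchain
            exact absurd hchain.2.1 (h.not_isDownEdge x)
        subst hγ
        rcases h.eq_or_eq_of_isDownEdge hchain.1 with rfl | rfl
        · have h1 : ¬ IsLeftOf v (wordAct w (0, 1)) := by
            unfold IsLeftOf at hl ⊢; omega
          have h2 : wordAct w (1, 0) ≠ v := by
            rintro h3; rw [h3] at hr; unfold IsLeftOf at hr; omega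
          simp [crossingsUntil, huE, h.not_crosses, h1, h2, Ne.symm huR]
        · exact absurd rfl huR
      · obtain ⟨i1, i2⟩ := ih v hv hchain.2 hlast
        have hc := h.crosses_iff hchain.1 hv
        have e1 : wordAct w (1, 0) ∈ u :: v :: γ ↔ wordAct w (1, 0) ∈ v :: γ := by
          rw [List.mem_cons]
          exact or_iff_right (Ne.symm huR)
        refine ⟨?_, i2.imp (List.mem_cons_of_mem _) (List.mem_cons_of_mem _)⟩
        rw [e1, ← i1, crossingsUntil, if_neg huE, Nat.even_add]
        by_cases hcr : Crosses α u v
        · have h1 : ¬ Even 1 := by decide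
          simp only [if_pos hcr, h1, false_iff]
          exact not_iff_iff_iff_of_not_iff (hc.1 hcr)
        · have h2 : IsLeftOf A u ↔ IsLeftOf A v := by
            by_contra h3
            exact hcr (hc.2 h3)
          simp [if_neg hcr, h2]

theorem distinctTypes (h : IsVertexWord α A w) {L R : FareyVertex} (hLR : IsFundamental α L R) :
    DistinctTypes (parityType L) (parityType R) := by
  obtain ⟨-, -, -, w', hw'⟩ := h.spec hLR
  have := (endParallel_typePlace w' (1, 1) (by decide) _ _ distinctTypes_top).2
  rwa [hw'] at this

/-! ### Existence of Seifert paths -/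

end IsVertexWord

/-- There is a downward path from `1/0` to `v` which avoids the vertices of the parity type `X`. -/
def HasAvoidingPath (α : ℚ) (X : ZMod 2 × ZMod 2) (v : FareyVertex) : Prop :=
  ∃ γ : List FareyVertex, γ.head? = some (1, 0) ∧ γ.getLast? = some v ∧
    γ.IsChain (fun u v => IsDownEdge α u v ∧ parityType u ≠ parityType v) ∧
      ∀ x ∈ γ, parityType x ≠ X ∧ parityType x ≠ 0

theorem HasAvoidingPath.concat {α : ℚ} {X : ZMod 2 × ZMod 2} {u v : FareyVertex}
    (h : HasAvoidingPath α X u) (huv : IsDownEdge α u v) (hne : parityType u ≠ parityType v)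
    (hv : parityType v ≠ X ∧ parityType v ≠ 0) : HasAvoidingPath α X v := by
  obtain ⟨γ, h1, h2, h3, h4⟩ := h
  refine ⟨γ ++ [v], by simp [h1], by simp, ?_, ?_⟩
  · rw [List.isChain_append]
    refine ⟨h3, List.isChain_singleton _, ?_⟩
    intro x hx y hy
    rw [h2] at hx
    simp at hx hy
    subst hx hy
    exact ⟨huv, hne⟩
  · intro x hx
    rcases List.mem_append.1 hx with hx | hx
    · exact h4 x hx
    · rw [List.mem_singleton.1 hx]; exact hv

namespace IsVertexWord

variable {α : ℚ} {A : FareyVertex} {w : List Bool}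

/-- The two upper vertices have different types, so at least one of them is not of type `X`, and a
path to it can be prolonged. -/
theorem hasAvoidingPath_bottom (h : IsVertexWord α A w) {X : ZMod 2 × ZMod 2}
    {L R : FareyVertex} (hLR : IsFundamental α L R)
    (hl : parityType L ≠ X → HasAvoidingPath α X L)
    (hr : parityType R ≠ X → HasAvoidingPath α X R) (hb : parityType (L + R) ≠ X) :
    HasAvoidingPath α X (L + R) := by
  have hd := h.distinctTypes hLR
  have key : ∀ x y : ZMod 2 × ZMod 2, DistinctTypes x y →
      x ≠ x + y ∧ y ≠ x + y ∧ x + y ≠ 0 := by decide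
  obtain ⟨k1, k2, k3⟩ := key _ _ hd
  rw [← parityType_add] at k1 k2 k3
  by_cases hL : parityType L = X
  · exact (hr fun hR => hd.2.2 (hL.trans hR.symm)).concat
      (Or.inr ⟨L, R, hLR, Or.inr rfl, rfl⟩) k2 ⟨hb, k3⟩
  · exact (hl hL).concat (Or.inr ⟨L, R, hLR, Or.inl rfl, rfl⟩) k1 ⟨hb, k3⟩

theorem hasAvoidingPath_of_isFundamental (h : IsVertexWord α A w) {X : ZMod 2 × ZMod 2}
    (hX : X ≠ (1, 0)) {L R : FareyVertex} (hLR : IsFundamental α L R) :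
    (parityType L ≠ X → HasAvoidingPath α X L) ∧ (parityType R ≠ X → HasAvoidingPath α X R) := by
  induction hLR with
  | top =>
    have h0 : HasAvoidingPath α X (1, 0) := by
      refine ⟨[(1, 0)], rfl, rfl, List.isChain_singleton _, ?_⟩
      simp [parityType, Ne.symm hX]
    refine ⟨fun hl => h0.concat (Or.inl ⟨rfl, rfl⟩) ?_ ⟨hl, ?_⟩, fun _ => h0⟩ <;>
      simp [parityType]
  | left hLR _ ih => exact ⟨ih.1, h.hasAvoidingPath_bottom hLR ih.1 ih.2⟩
  | right hLR _ ih => exact ⟨h.hasAvoidingPath_bottom hLR ih.1 ih.2, ih.2⟩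

end IsVertexWord

/-- The parity type that does not occur on `γ_α`. -/
def excludedType (t : ZMod 2 × ZMod 2) : ZMod 2 × ZMod 2 := if t = (1, 1) then (0, 1) else (1, 1)

theorem excludedType_spec (t : ZMod 2 × ZMod 2) :
    excludedType t ≠ 0 ∧ excludedType t ≠ (1, 0) ∧ t ≠ excludedType t := by
  revert t; decide

theorem IsVertexWord.exists_isMainSeifertPath {α : ℚ} {A : FareyVertex} {w : List Bool}
    (h : IsVertexWord α A w) (hA : toVertex α = A) : ∃ γ, IsMainSeifertPath α γ := by
  obtain ⟨e1, e2, e3⟩ := excludedType_spec (parityType A)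
  obtain ⟨hl, hr⟩ := h.hasAvoidingPath_of_isFundamental e2 h.isFundamental
  have hb := h.hasAvoidingPath_bottom h.isFundamental hl hr
  rw [← wordAct_one, ← h.eq_act] at hb
  obtain ⟨γ, h1, h2, h3, h4⟩ := hb e3
  have k1 : ∀ x : ZMod 2 × ZMod 2, x ≠ (0, 1) → x ≠ 0 → x = (1, 1) ∨ x = (1, 0) := by decide
  have k2 : ∀ x : ZMod 2 × ZMod 2, x ≠ (1, 1) → x ≠ 0 → x = (1, 0) ∨ x = (0, 1) := by decide
  have pair : ∀ a b : ZMod 2 × ZMod 2, (∀ x ∈ γ, parityType x = a ∨ parityType x = b) →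
      γ.IsChain (fun u v => ({parityType u, parityType v} : Set _) = {a, b}) := by
    intro a b hab
    refine List.IsChain.imp_of_mem_imp ?_ h3
    intro x y hx hy hxy
    rcases hab x hx with hx | hx <;> rcases hab y hy with hy | hy
    · exact absurd (hx.trans hy.symm) hxy.2
    · rw [hx, hy]
    · rw [hx, hy, Set.pair_comm]
    · exact absurd (hx.trans hy.symm) hxy.2
  refine ⟨γ, ⟨h1, by rw [hA, h2], h3.imp fun _ _ hxy => hxy.1, ?_⟩, ?_⟩
  · by_cases hT : parityType A = (1, 1)
    · rw [excludedType, if_pos hT] at h4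
      exact Or.inl (pair _ _ fun x hx => k1 _ (h4 x hx).1 (h4 x hx).2)
    · rw [excludedType, if_neg hT] at h4
      exact Or.inr (pair _ _ fun x hx => k2 _ (h4 x hx).1 (h4 x hx).2)
  · intro hT x hx
    rw [hA] at hT
    rw [excludedType, hT, if_neg (by decide)] at h4
    exact k2 _ (h4 x hx).1 (h4 x hx).2

theorem isMainSeifertPath_seifertPath {α : ℚ} (h : ∃ γ, IsMainSeifertPath α γ) :
    IsMainSeifertPath α (seifertPath α) := by
  rw [seifertPath, dif_pos h]; exact h.choose_spec

/-! ### The parity type avoided by a Seifert path -/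

theorem parityType_mem_of_isChain {a b : ZMod 2 × ZMod 2} (γ : List FareyVertex)
    (hlen : 2 ≤ γ.length)
    (h : γ.IsChain (fun u v => ({parityType u, parityType v} : Set _) = {a, b})) :
    ∀ x ∈ γ, parityType x = a ∨ parityType x = b := by
  induction γ with
  | nil => simp
  | cons u γ ih =>
    cases γ with
    | nil => simp at hlen
    | cons v γ =>
      rw [List.isChain_cons_cons] at h
      have hu : parityType u ∈ ({a, b} : Set (ZMod 2 × ZMod 2)) := by rw [← h.1]; simp
      have hv : parityType v ∈ ({a, b} : Set (ZMod 2 × ZMod 2)) := by rw [← h.1]; simp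
      intro x hx
      rcases List.mem_cons.1 hx with rfl | hx
      · simpa using hu
      · cases γ with
        | nil => rw [List.mem_singleton.1 hx]; simpa using hv
        | cons y γ => exact ih (by simp) h.2 x hx

/-- The vertices of `γ_α` are not of the excluded type. -/
theorem IsMainSeifertPath.parityType_ne {α : ℚ} {γ : List FareyVertex} (h : IsMainSeifertPath α γ)
    (hne : toVertex α ≠ (1, 0)) :
    ∀ x ∈ γ, parityType x ≠ excludedType (parityType (toVertex α)) := by
  obtain ⟨⟨h1, h2, -, h4⟩, h5⟩ := h
  have hlen : 2 ≤ γ.length := by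
    match γ, h1, h2 with
    | [x], h1, h2 =>
      simp at h1 h2
      exact absurd (h2.symm.trans h1) hne
    | x :: y :: γ, _, _ => simp
  have hmem : toVertex α ∈ γ := List.mem_of_getLast? h2
  intro x hx
  rcases h4 with h4 | h4
  · have hx' := parityType_mem_of_isChain γ hlen h4 x hx
    have hA := parityType_mem_of_isChain γ hlen h4 _ hmem
    rcases hA with hA | hA
    · rw [hA]
      rcases hx' with hx' | hx' <;> rw [hx'] <;> decide
    · have := h5 hA x hx
      rw [hA]
      rcases this with hx' | hx' <;> rw [hx'] <;> decide
  · have hx' := parityType_mem_of_isChain γ hlen h4 x hx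
    have hA := parityType_mem_of_isChain γ hlen h4 _ hmem
    rcases hA with hA | hA <;> rw [hA] <;> rcases hx' with hx' | hx' <;> rw [hx'] <;> decide

/-- The parity of the number of crossings of `γ_α`, in terms of the diagram of `α`. -/
theorem IsVertexWord.pow_crossingsUntil {α : ℚ} {A : FareyVertex} {w : List Bool}
    (h : IsVertexWord α A w) (hA : toVertex α = A) :
    (-1 : ℤ) ^ crossingsUntil α {A, wordAct w (1, 0)} (seifertPath α) =
      sideSign (endParallel w (startParallel (excludedType (parityType A)))) := by
  have hγ := isMainSeifertPath_seifertPath (h.exists_isMainSeifertPath hA)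
  have hp := h.pos
  have hne : (1, 0) ≠ A := by
    rintro rfl
    simp at hp
  have htype := hγ.parityType_ne (by rw [hA]; exact hne.symm)
  obtain ⟨⟨h1, h2, h3, -⟩, -⟩ := hγ
  rw [hA] at h2 htype
  generalize seifertPath α = γ at *
  obtain ⟨e1, e2, e3⟩ := excludedType_spec (parityType A)
  generalize excludedType (parityType A) = X at *
  obtain ⟨d1, d2⟩ := endParallel_startParallel w X e1
  cases γ with
  | nil => simp at h1
  | cons u γ =>
    simp at h1
    subst h1
    obtain ⟨c1, c2⟩ := h.even_crossingsUntil γ (1, 0) hne h3 h2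
    have hleft : IsLeftOf A (1, 0) := by simpa [IsLeftOf] using hp.2
    rw [iff_true_right hleft] at c1
    -- A triangle has one vertex of type `X`. It is not `α`, and a path missing the right vertex
    -- passes through the left one, so it must be the right vertex.
    have key : ∀ l r X : ZMod 2 × ZMod 2, DistinctTypes l r → X ≠ 0 → l + r ≠ X → l ≠ X →
        r = X := by decide
    simp only [sideSign, d1, typePlace_eq_zero_iff _ _ _ d2]
    by_cases hR : wordAct w (1, 0) ∈ (1, 0) :: γ
    · rw [if_neg (htype _ hR), (c1.2 hR).neg_one_pow]
    · have hL := htype _ (c2.resolve_right hR)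
      rw [h.eq_act, wordAct_one, parityType_add] at e3
      rw [if_pos (key _ _ _ d2 e1 e3 hL), (Nat.not_even_iff_odd.1 (mt c1.1 hR)).neg_one_pow]

/-! ### Writhes of vertices -/

theorem startParallel_excludedType (t : ZMod 2 × ZMod 2) :
    startParallel (excludedType t) = if t = (1, 1) then 2 else 1 := by
  revert t; decide

theorem wrPM_eq (α : ℚ) (h0 : 0 < α) (h1 : α < 1) (w : List Bool)
    (hw : toVertex α = wordAct w (1, 1)) : wrPM α = wordWrithe (w ++ [true]) 2 := by
  rw [wrPM, rationalDiagram_eq α h0 h1 w hw, leftDirs_neg_one, diagramWrithe_parallelDirs]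

theorem wr_eq (α : ℚ) (h0 : 0 < α) (h1 : α < 1) (w : List Bool)
    (hw : toVertex α = wordAct w (1, 1)) :
    wr α = wordWrithe (w ++ [true]) (if parityType (toVertex α) = (1, 1) then 2 else 1) := by
  -- The extra final `true` exchanges states `0` and `1`, so the closing condition becomes a
  -- condition on the bottom vertex of the word.
  have hend : ∀ k : Fin 3, nextParallel true k ≠ 0 ↔ k ≠ 1 := by decide
  have hor : IsOrientation (rationalDiagram α) (leftDirs 1) ↔
      parityType (toVertex α) ≠ (1, 1) := by
    rw [rationalDiagram_eq α h0 h1 w hw, leftDirs_one, isOrientation_parallelDirs,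
      endParallel_append, endParallel, endParallel, hend, hw]
    exact (and_iff_right (by decide)).trans
      (not_congr (endParallel_eq_one_iff w (1, 1) (by decide)))
  have heven : Even α.den → parityType (toVertex α) ≠ (1, 1) := by
    intro h h'
    have : ((α.den : ℕ) : ZMod 2) = 1 := congrArg Prod.snd h'
    rw [(ZMod.natCast_eq_zero_iff_even).2 h] at this
    exact absurd this (by decide)
  rw [wr, stdDirs, rationalDiagram_eq α h0 h1 w hw]
  rw [rationalDiagram_eq α h0 h1 w hw] at hor
  split_ifs with h2 h3 h3 h3 h3
  · exact absurd h3 (heven h2)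
  · rw [leftDirs_one, diagramWrithe_parallelDirs]
  · exact absurd h3 (hor.1 ‹_›)
  · rw [leftDirs_one, diagramWrithe_parallelDirs]
  · rw [leftDirs_neg_one, diagramWrithe_parallelDirs]
  · exact absurd (hor.2 h3) ‹_›

/-- The right step makes the old bottom vertex the left one, and left steps keep it there. So
`α_{j-1}` is the left vertex of the last triangle of `α_j`. -/
theorem wordAct_extend_left (w : List Bool) (m : ℕ) :
    wordAct (w ++ false :: List.replicate m true) (0, 1) = wordAct w (1, 1) := by
  simp [wordAct_append, wordAct, wordAct_replicate_true]

theorem wordAct_extend_bottom (w : List Bool) (c : ℕ) (hc : 2 ≤ c) :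
    wordAct (w ++ false :: List.replicate (c - 2) true) (1, 1) + wordAct w (0, 1) =
      c • wordAct w (1, 1) := by
  obtain ⟨n, rfl⟩ := Nat.exists_eq_add_of_le' hc
  rw [← wordAct_nsmul, wordAct_append, ← wordAct_add]
  congr 1
  simp [wordAct, wordAct_replicate_true]
  omega

/-! ### The convergents of a negative continued fraction -/

/-- The word of `1 / [c₁, …, c_{n+1}]⁻`. -/
def convWord (c : ℕ → ℕ) (n : ℕ) : List Bool :=
  negWord ((List.range n).map fun i => c (i + 1)) (c (n + 1))

theorem convWord_succ (c : ℕ → ℕ) (n : ℕ) :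
    convWord c (n + 1) = convWord c n ++ false :: List.replicate (c (n + 2) - 2) true := by
  rw [convWord, List.range_succ, List.map_append]
  exact negWord_append _ _ _

theorem negConv_spec (c : ℕ → ℕ) (n : ℕ) (hc : ∀ j, 1 ≤ j → j ≤ n + 1 → 2 ≤ c j) :
    toVertex (negConv c (n + 1)) = wordAct (convWord c n) (1, 1) ∧
      toVertex (negConvPred c (n + 1)) = wordAct (convWord c n) (1, 0) ∧
      0 < negConv c (n + 1) ∧ negConv c (n + 1) < 1 ∧
      IsVertexWord (negConv c (n + 1)) (wordAct (convWord c n) (1, 1)) (convWord c n) := by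
  have hcs : ∀ x ∈ (List.range n).map fun i => c (i + 1), 2 ≤ x := by
    intro x hx
    obtain ⟨i, hi, rfl⟩ := List.mem_map.1 hx
    have := List.mem_range.1 hi
    exact hc _ (by omega) (by omega)
  have hd : 2 ≤ c (n + 1) := hc _ (by omega) le_rfl
  -- Taking `y = 1` gives the bottom vertex, with last quotient `c (n + 1)`; `y = 0` below gives the
  -- right vertex, with that quotient lowered by one.
  obtain ⟨h1, h2⟩ := toVertex_negCF _ hcs _ hd 1
  have h3 := (toVertex_negCF _ hcs _ hd 0).1
  rw [Nat.sub_add_cancel (by omega)] at h1 h2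
  have h4 : negConv c (n + 1) =
      1 / negCF (((List.range n).map fun i => c (i + 1)) ++ [c (n + 1)]) := by
    rw [negConv, List.range_succ, List.map_append]; rfl
  have hp := wordAct_one_pos (convWord c n)
  have hlt : (wordAct (convWord c n) (1, 1)).1 < (wordAct (convWord c n) (1, 1)).2 := by
    have := wordAct_one_pos (negWordTail ((List.range n).map fun i => c (i + 1)) (c (n + 1)))
    simp only [convWord, negWord, wordAct]
    omega
  rw [← h4] at h1 h2
  have h5 : negConv c (n + 1) =
      ((wordAct (convWord c n) (1, 1)).1 : ℚ) / (wordAct (convWord c n) (1, 1)).2 := by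
    have h6 : ((negConv c (n + 1)).num.toNat : ℤ) = (negConv c (n + 1)).num :=
      Int.toNat_of_nonneg (Rat.num_pos.2 h2).le
    conv_lhs => rw [← Rat.num_div_den (negConv c (n + 1)), ← h6]
    rw [convWord, ← h1]
    rfl
  refine ⟨h1, h3, h2, ?_, h5, rfl⟩
  rw [h5, div_lt_one (by exact_mod_cast hp.2)]
  exact_mod_cast hlt

theorem pow_zConv (c : ℕ → ℕ) (n : ℕ) (hc : ∀ j, 1 ≤ j → j ≤ n + 1 → 2 ≤ c j) :
    (-1 : ℤ) ^ zConv c (n + 1) = sideSign (endParallel (convWord c n)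
      (if parityType (toVertex (negConv c (n + 1))) = (1, 1) then 2 else 1)) := by
  obtain ⟨h1, h2, -, -, h3⟩ := negConv_spec c n hc
  rw [← startParallel_excludedType, zConv, h2, h1]
  exact h3.pow_crossingsUntil h1

/-- If both orientations are admissible, their final states are distinct and differ from `1`, hence
are `0` and `2`. This trades the orientation `+-` for the orientation `++` that governs `z_j`, at
the cost of a sign. -/
theorem sideSign_endParallel_two (w : List Bool) (h1 : endParallel w 1 ≠ 1)
    (h2 : endParallel w 2 ≠ 1) :
    sideSign (endParallel w 2) = -sideSign (endParallel w 1) := by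
  have h : endParallel w 1 ≠ endParallel w 2 := fun h =>
    absurd (endParallel_injective w h) (by decide)
  revert h h1 h2
  generalize endParallel w 1 = x
  generalize endParallel w 2 = y
  revert x y
  decide

/-! ### The writhe formulas -/

theorem theorem2p11 (α : ℚ) (hα0 : 0 < α) (hα1 : α < 1)
    (l : ℕ) (hl : 1 ≤ l) (c : ℕ → ℕ) (hc : ∀ j, 1 ≤ j → j ≤ l → 2 ≤ c j)
    (hαc : α⁻¹ = negCF ((List.range l).map fun i => c (i + 1))) :
    -- (1)
    (l = 1 →
      wr α = (-1) ^ c 1 * (c 1 : ℤ) ∧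
      (Even (c 1) → wrPM α = -(c 1 : ℤ))) ∧
    -- (2)
    (l = 2 →
      wr α = (-1) ^ ((c 1 - 1) * c 2) * (c 1 : ℤ) + (-1) ^ c 1 * (c 2 : ℤ) - 1 ∧
      (Odd (c 1) → Odd (c 2) → wrPM α = -(c 1 : ℤ) + (c 2 : ℤ) - 1)) ∧
    -- (3)
    (3 ≤ l →
      -- (i)
      (parityType (toVertex (negConv c (l - 1))) = (1, 0) →
        parityType (toVertex α) = (1, 1) →
        wr α = wrPM (negConv c (l - 1)) +
          (-1) ^ (zConv c (l - 1) + evenInd (c l) + 1) * ((c l : ℤ) - 1)) ∧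
      -- (ii)
      (parityType (toVertex (negConv c (l - 1))) = (0, 1) →
        parityType (toVertex α) = (1, 1) →
        wr α = wrSigned (eps (c l)) (negConv c (l - 2)) +
          (-1) ^ (zConv c (l - 2) + evenInd (c (l - 1)) + oddInd (c l)) *
            (-(c (l - 1) : ℤ) + (c l : ℤ) + 2)) ∧
      -- (iii)
      (parityType (toVertex (negConv c (l - 1))) = (1, 0) →
        parityType (toVertex α) = (0, 1) →
        wr α = wr (negConv c (l - 1)) +
          (-1) ^ (zConv c (l - 1) + evenInd (c l)) * ((c l : ℤ) - 1)) ∧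
      -- (iv)
      (parityType (toVertex (negConv c (l - 1))) = (1, 1) →
        parityType (toVertex α) = (0, 1) →
        wr α = wr (negConv c (l - 2)) +
          (-1) ^ (zConv c (l - 2) + evenInd (c (l - 1))) *
            (-(c (l - 1) : ℤ) + (c l : ℤ) + 2)) ∧
      -- (v)
      (parityType (toVertex (negConv c (l - 1))) = (0, 1) →
        parityType (toVertex α) = (1, 0) →
        wr α = wr (negConv c (l - 1)) +
          (-1) ^ (zConv c (l - 1) + evenInd (c l)) * ((c l : ℤ) - 1) ∧
        wrPM α = wrSigned (eps (c l - 1)) (negConv c (l - 2)) +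
          (-1) ^ (zConv c (l - 2) + evenInd (c (l - 1)) + evenInd (c l)) *
            (-(c (l - 1) : ℤ) + (c l : ℤ) + 2)) ∧
      -- (vi)
      (parityType (toVertex (negConv c (l - 1))) = (1, 1) →
        parityType (toVertex α) = (1, 0) →
        wr α = wr (negConv c (l - 2)) +
          (-1) ^ (zConv c (l - 2) + evenInd (c (l - 1))) *
            (-(c (l - 1) : ℤ) + (c l : ℤ) + 2) ∧
        wrPM α = wr (negConv c (l - 1)) +
          (-1) ^ (zConv c (l - 2) + evenInd (c (l - 1)) + 1) * ((c l : ℤ) - 1))) := by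
  have hα : α = negConv c l := by rw [negConv, ← hαc, one_div, inv_inv]
  subst hα
  refine ⟨?_, ?_, ?_⟩
  · rintro rfl
    obtain ⟨h1, -, h3, h4, -⟩ := negConv_spec c 0 hc
    have hc1 : 2 ≤ c 1 := hc 1 le_rfl le_rfl
    have hw : convWord c 0 ++ [true] = List.replicate (c 1) true := by
      obtain ⟨m, hm⟩ := Nat.exists_eq_add_of_le' hc1
      simp [convWord, negWord, negWordTail, hm, ← List.replicate_succ, ← List.replicate_succ']
    have ht : parityType (toVertex (negConv c 1)) = (1, ((c 1 : ℕ) : ZMod 2)) := by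
      rw [h1]
      obtain ⟨m, hm⟩ := Nat.exists_eq_add_of_le' hc1
      simp [convWord, negWord, negWordTail, hm, wordAct, wordAct_replicate_true, parityType]
      ring
    rw [wr_eq _ h3 h4 _ h1, wrPM_eq _ h3 h4 _ h1, hw, wordWrithe_replicate_true,
      wordWrithe_replicate_true, ht]
    by_cases he : Even (c 1)
    · rw [(ZMod.natCast_eq_zero_iff_even).2 he]
      simp [he, letterSign]
    · rw [(ZMod.natCast_eq_one_iff_odd).2 (Nat.not_even_iff_odd.1 he)]
      simp [he, letterSign, (Nat.not_even_iff_odd.1 he).neg_one_pow]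
  · rintro rfl
    obtain ⟨h1, -, h3, h4, -⟩ := negConv_spec c 1 hc
    have hc1 : 2 ≤ c 1 := hc 1 le_rfl (by omega)
    have hc2 : 2 ≤ c 2 := hc 2 (by omega) le_rfl
    have hw : convWord c 1 ++ [true] =
        List.replicate (c 1 - 1) true ++ false :: List.replicate (c 2 - 1) true := by
      obtain ⟨m, hm⟩ := Nat.exists_eq_add_of_le' hc1
      obtain ⟨k, hk⟩ := Nat.exists_eq_add_of_le' hc2
      simp [convWord, negWord, negWordTail, hm, hk, List.replicate_succ, ← List.replicate_succ']
    have ht : parityType (toVertex (negConv c 2)) =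
        (((c 2 : ℕ) : ZMod 2), ((c 1 : ℕ) : ZMod 2) * ((c 2 : ℕ) : ZMod 2) + 1) := by
      have h2 : (2 : ZMod 2) = 0 := by decide
      rw [h1]
      obtain ⟨m, hm⟩ := Nat.exists_eq_add_of_le' hc1
      obtain ⟨k, hk⟩ := Nat.exists_eq_add_of_le' hc2
      simp [convWord, negWord, negWordTail, hm, hk, wordAct, wordAct_append,
        wordAct_replicate_true, parityType]
      constructor
      · ring
      · linear_combination (-1 : ZMod 2) * h2
    rw [wr_eq _ h3 h4 _ h1, wrPM_eq _ h3 h4 _ h1, hw]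
    simp only [wordWrithe_append, wordWrithe, endParallel_replicate_true,
      wordWrithe_replicate_true, ht, pow_mul]
    rcases Nat.even_or_odd (c 1) with he1 | he1 <;> rcases Nat.even_or_odd (c 2) with he2 | he2
    · have o1 : Odd (c 1 - 1) := by
        rw [← Nat.not_even_iff_odd, even_sub_one_iff _ hc1]; simpa using he1
      rw [(ZMod.natCast_eq_zero_iff_even).2 he1, (ZMod.natCast_eq_zero_iff_even).2 he2]
      simp [he1, he2, o1.neg_one_pow, Nat.not_even_iff_odd.2 o1, Nat.not_odd_iff_even.2 he1,
        letterSign, nextParallel, Equiv.swap_apply_def]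
      omega
    · have o1 : Odd (c 1 - 1) := by
        rw [← Nat.not_even_iff_odd, even_sub_one_iff _ hc1]; simpa using he1
      rw [(ZMod.natCast_eq_zero_iff_even).2 he1, (ZMod.natCast_eq_one_iff_odd).2 he2]
      simp [he1, he2.neg_one_pow, o1.neg_one_pow, Nat.not_even_iff_odd.2 o1,
        Nat.not_odd_iff_even.2 he1, letterSign, nextParallel, Equiv.swap_apply_def]
      omega
    · have o1 : Even (c 1 - 1) := by
        rw [even_sub_one_iff _ hc1]; simpa using he1
      rw [(ZMod.natCast_eq_one_iff_odd).2 he1, (ZMod.natCast_eq_zero_iff_even).2 he2]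
      simp [he1.neg_one_pow, o1, Nat.not_odd_iff_even.2 he2, letterSign, nextParallel]
      omega
    · have o1 : Even (c 1 - 1) := by
        rw [even_sub_one_iff _ hc1]; simpa using he1
      rw [(ZMod.natCast_eq_one_iff_odd).2 he1, (ZMod.natCast_eq_one_iff_odd).2 he2]
      simp [he1.neg_one_pow, he1, he2, o1, letterSign, nextParallel]
      constructor <;> omega
  · intro hl3
    obtain ⟨n, rfl⟩ := Nat.exists_eq_add_of_le' hl3
    rw [show n + 3 - 1 = n + 2 from rfl, show n + 3 - 2 = n + 1 from rfl]
    have hc2 : 2 ≤ c (n + 3) := hc _ (by omega) le_rfl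
    have hc1 : 2 ≤ c (n + 2) := hc _ (by omega) (by omega)
    have hz0 := pow_zConv c n fun j h h' => hc j h (by omega)
    have hz1 := pow_zConv c (n + 1) fun j h h' => hc j h (by omega)
    obtain ⟨v0, -, p0, q0, -⟩ := negConv_spec c n fun j h h' => hc j h (by omega)
    obtain ⟨v1, -, p1, q1, -⟩ := negConv_spec c (n + 1) fun j h h' => hc j h (by omega)
    obtain ⟨v2, -, p2, q2, -⟩ := negConv_spec c (n + 2) fun j h h' => hc j h (by omega)
    have hwr0 := wr_eq _ p0 q0 _ v0
    have hwr1 := wr_eq _ p1 q1 _ v1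
    have hwr2 := wr_eq _ p2 q2 _ v2
    have hpm0 := wrPM_eq _ p0 q0 _ v0
    have hpm1 := wrPM_eq _ p1 q1 _ v1
    have hpm2 := wrPM_eq _ p2 q2 _ v2
    have w1 : convWord c (n + 1) =
      convWord c n ++ false :: List.replicate (c (n + 2) - 2) true := convWord_succ c n
    have w2 : convWord c (n + 2) =
      convWord c (n + 1) ++ false :: List.replicate (c (n + 3) - 2) true := convWord_succ c (n + 1)
    -- The recurrence `α_l + α_{l-2} = c_l • α_{l-1}` for pairs, modulo `2`; it determines the type
    -- of `α_{l-2}` from the other two.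
    have hrel : parityType (toVertex (negConv c (n + 3))) +
        parityType (toVertex (negConv c (n + 1))) =
        if Even (c (n + 3)) then 0 else parityType (toVertex (negConv c (n + 2))) := by
      have h := wordAct_extend_bottom (convWord c (n + 1)) _ hc2
      rw [← w2] at h
      conv at h => lhs; rw [w1, wordAct_extend_left]
      rw [v0, v1, v2, ← parityType_add, h]
      split_ifs with he
      · simp [parityType, (ZMod.natCast_eq_zero_iff_even).2 he]
      · simp [parityType, (ZMod.natCast_eq_one_iff_odd).2 (Nat.not_even_iff_odd.1 he)]
    have hplace : ∀ w : List Bool, (endParallel w 1 = 1 ↔ parityType (wordAct w (1, 1)) = (1, 1)) ∧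
        (endParallel w 2 = 1 ↔ parityType (wordAct w (1, 1)) = (0, 1)) := fun w =>
      ⟨endParallel_eq_one_iff w (1, 1) (by decide), endParallel_eq_one_iff w (0, 1) (by decide)⟩
    obtain ⟨i0, j0⟩ := hplace (convWord c n)
    obtain ⟨i1, j1⟩ := hplace (convWord c (n + 1))
    obtain ⟨i2, j2⟩ := hplace (convWord c (n + 2))
    rw [← v0] at i0 j0
    rw [← v1] at i1 j1
    rw [← v2] at i2 j2
    have ext1 := fun k => wordWrithe_extend (convWord c (n + 1)) k _ hc2
    have ext2 := fun k => wordWrithe_extend_extend (convWord c n) k _ _ hc1 hc2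
    rw [← w2] at ext1
    rw [← w1, ← w2] at ext2
    have opp0 := sideSign_endParallel_two (convWord c n)
    have opp1 := sideSign_endParallel_two (convWord c (n + 1))
    clear v0 v1 v2 w1 w2 hplace p0 p1 p2 q0 q1 q2 hc hαc
    generalize parityType (toVertex (negConv c (n + 1))) = a0 at *
    generalize parityType (toVertex (negConv c (n + 2))) = a1 at *
    generalize parityType (toVertex (negConv c (n + 3))) = a2 at *
    have hc' : Even (c (n + 3) - 1) ↔ ¬ Even (c (n + 3)) := even_sub_one_iff _ hc2
    simp only [pow_add, pow_one, hz0, hz1, hwr0, hwr1, hwr2, hpm0, hpm1, hpm2, wrSigned, eps, hc',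
      oddInd_pow, evenInd_pow (c (n + 3))]
    clear hz0 hz1 hwr0 hwr1 hwr2 hpm0 hpm1 hpm2
    have t1 : ∀ a : ZMod 2 × ZMod 2, (1, 1) + a = 0 → a = (1, 1) := by decide
    have t2 : ∀ a : ZMod 2 × ZMod 2, (1, 0) + a = 0 → a = (1, 0) := by decide
    have t3 : ∀ a : ZMod 2 × ZMod 2, (1, 1) + a = (0, 1) → a = (1, 0) := by decide
    have t4 : ∀ a : ZMod 2 × ZMod 2, (1, 0) + a = (0, 1) → a = (1, 1) := by decide
    have t5 : (1 : ℤˣ) ≠ -1 := by decide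
    refine ⟨?_, ?_, ?_, ?_, ?_, ?_⟩
    · rintro rfl rfl
      obtain ⟨e, s⟩ := ext1 2 (mt j1.1 (by decide)) (mt j2.1 (by decide))
      -- The writhe follows state `2`, whereas `z_{l-1}` belongs to state `1` because `α_{l-1}` is
      -- of type `1/0`; this accounts for the extra `+ 1` in the exponent.
      have o := opp1 (mt i1.1 (by decide)) (mt j1.1 (by decide))
      rw [evenInd_pow] at s
      rw [if_pos rfl, if_neg (by decide), e]
      linear_combination (-(c (n + 3) : ℤ) + 1) * s +
        (if Even (c (n + 3)) then -1 else 1) * ((c (n + 3) : ℤ) - 1) * o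
    · rintro rfl rfl
      obtain ⟨e, s, r⟩ := ext2 2 (j1.2 rfl)
      rw [if_pos rfl, e]
      -- For even `c_l`, `α_{l-2}` has type `1/1` and state `2` gives its `wr`; for odd `c_l` it has
      -- type `1/0`, state `2` gives its `wrPM`, and `o` supplies the sign of `oddInd`.
      by_cases he : Even (c (n + 3))
      · rw [if_pos he] at hrel
        obtain rfl := t1 _ hrel
        simp only [he, if_true]
        linear_combination (-(c (n + 2) : ℤ) + c (n + 3) + 2) * (-s)
      · rw [if_neg he] at hrel
        obtain rfl := t3 _ hrel
        have o := opp0 (mt i0.1 (by decide)) r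
        simp only [he, if_false, t5.symm,
          if_neg (show ¬ ((1, 0) : ZMod 2 × ZMod 2) = (1, 1) by decide)]
        linear_combination
          (-(c (n + 2) : ℤ) + c (n + 3) + 2) * (-s + (-1) ^ evenInd (c (n + 2)) * o)
    · rintro rfl rfl
      obtain ⟨e, s⟩ := ext1 1 (mt i1.1 (by decide)) (mt i2.1 (by decide))
      rw [evenInd_pow] at s
      rw [if_neg (by decide), if_neg (by decide), e]
      linear_combination (-(c (n + 3) : ℤ) + 1) * s
    · rintro rfl rfl
      obtain ⟨e, s, r⟩ := ext2 1 (i1.2 rfl)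
      -- By `r`, `α_{l-2}` is not of type `1/1`, so its `wr` and `z_{l-2}` also belong to state `1`.
      rw [if_neg (by decide), if_neg (mt i0.2 r), e]
      linear_combination (-(c (n + 2) : ℤ) + c (n + 3) + 2) * (-s)
    · rintro rfl rfl
      constructor
      · obtain ⟨e, s⟩ := ext1 1 (mt i1.1 (by decide)) (mt i2.1 (by decide))
        rw [evenInd_pow] at s
        rw [if_neg (by decide), if_neg (by decide), e]
        linear_combination (-(c (n + 3) : ℤ) + 1) * s
      · obtain ⟨e, s, r⟩ := ext2 2 (j1.2 rfl)
        rw [e]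
        by_cases he : Even (c (n + 3))
        · rw [if_pos he] at hrel
          obtain rfl := t2 _ hrel
          have o := opp0 (mt i0.1 (by decide)) r
          simp only [he, not_true, if_false, if_true, t5.symm,
            if_neg (show ¬ ((1, 0) : ZMod 2 × ZMod 2) = (1, 1) by decide)]
          linear_combination
            (-(c (n + 2) : ℤ) + c (n + 3) + 2) * (-s + (-1) ^ evenInd (c (n + 2)) * o)
        · rw [if_neg he] at hrel
          obtain rfl := t4 _ hrel
          simp only [he, not_false_eq_true, if_true, if_false]
          linear_combination (-(c (n + 2) : ℤ) + c (n + 3) + 2) * (-s)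
    · rintro rfl rfl
      obtain ⟨e, s, r⟩ := ext2 1 (i1.2 rfl)
      -- State `2` is admissible at `α_{l-1}`, so `wrPM` grows by exactly `c_l - 1`; by `s` the sign
      -- factor in the claim equals `1`.
      obtain ⟨e', -⟩ := ext1 2 (mt j1.1 (by decide)) (mt j2.1 (by decide))
      rw [if_neg (by decide), if_neg (mt i0.2 r), if_pos rfl, e, e']
      constructor
      · linear_combination (-(c (n + 2) : ℤ) + c (n + 3) + 2) * (-s)
      · linear_combination ((c (n + 3) : ℤ) - 1) * s
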